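/- Let $d\in\mathbb N$, $T>0$, $u_0\in L^\infty(\mathbb R^d)$, and let $f:[0,T]\times\mathbb R^d\times\mathbb R\to\mathbb R^d$, $F:[0,T]\times\mathbb R^d\times\mathbb R\to\mathbb R$. Consider $$\text{(B.1)}\qquad \partial_t u+\operatorname{Div} f(t,x,u)=F(t,x,u)\ \text{ on }[0,T]\times\mathbb R^d,\qquad u(0,x)=u_0(x)\ \text{ on }\mathbb R^d,$$ where $\operatorname{Div}$ is the total divergence of $x\mapsto f(t,x,u(t,x))$. Below, $\nabla$ and $\operatorname{div}$ are taken in the variable $x$ only, with $t$ and $u$ fixed. *Weak entropy solution.* $u\in L^\infty([0,T]\times\mathbb R^d)$ is a weak entropy solution of (B.1) if (i) for all $k\in\mathbb R$ and all $\varphi\in C_c^\infty((0,T)\times\mathbb R^d)$ with $\varphi\ge0$, $$\int_0^T\!\!\int_{\mathbb R^d}|u-k|\,\partial_t\varphi+\operatorname{sgn}(u-k)\,(f(t,x,u)-f(t,x,k))\cdot\nabla\varphi+\operatorname{sgn}(u-k)\,(F(t,x,u)-\operatorname{div}f(t,x,k))\,\varphi\;dx\,dt\ \ge 0,$$ (ii)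 there is a null set $\mathcal E\subseteq[0,T]$ such that for $t\in[0,T]\setminus\mathcal E$ the function $u(t,\cdot)$ is a measurable function defined a.e., and $\lim_{t\downarrow0,\,t\notin\mathcal E}\int_{B_r(0)}|u(t,x)-u_0(x)|\,dx=0$ for all $r>0$. *Hypotheses.* (H1) $f,F$ are continuous; $\partial_uf,\ \partial_u\nabla f,\ \nabla^2f,\ \partial_uF,\ \nabla F$ exist and are continuous; and $\partial_uf,\ F-\operatorname{div}f,\ \partial_u(F-\operatorname{div}f)\in L^\infty([0,T]\times\mathbb R^d\times[-U,U])$ for all $U>0$. (H2) For all $U>0$: $\nabla\partial_uf,\ \partial_uF\in L^\infty([0,T]\times\mathbb R^d\times[-U,U])$ and $\int_0^T\int_{\mathbb R^d}\|\nabla(F-\operatorname{div}f)(t,x,\cdot)\|_{L^\infty([-U,U])}\,dx\,dt<\infty$. (H2*) For all $U,R>0$: $\nabla\partial_uf,\ \partial_uF\in L^\infty([0,T]\times\mathbb R^d\times[-U,U])$ and $\int_0^T\int_{B_R(0)}\|\nabla(F-\operatorname{div}f)(t,x,\cdot)\|_{L^\infty([-U,U])}\,dx\,dt<\infty$. **Corollary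 B.4 (uniqueness of weak entropy solutions).** Assume that $f,F$ satisfy (H1) and (H2*). Let $u$ be a weak entropy solution of (B.1), and suppose that for every $\varepsilon>0$ there are $f^\varepsilon,F^\varepsilon$ satisfying (H1) and (H2), $u_0^\varepsilon\in L^\infty(\mathbb R^d)$, and a weak entropy solution $u^\varepsilon$ of $$\partial_tu^\varepsilon+\operatorname{Div}f^\varepsilon(t,x,u^\varepsilon)=F^\varepsilon(t,x,u^\varepsilon),\qquad u^\varepsilon(0,x)=u^\varepsilon_0(x),$$ such that $\sup_{\varepsilon>0}\|u^\varepsilon\|_{L^\infty([0,T]\times\mathbb R^d)}<\infty$, $u^\varepsilon\to u$ in $L^1([0,T];L^1_{loc}(\mathbb R^d))$ as $\varepsilon\to0$, and for every $R>0$ there is an $\varepsilon>0$ such that $$f^\varepsilon=f,\quad F^\varepsilon=F\quad\text{on }[0,T]\times B_R(0)\times\mathbb R,\qquad u_0^\varepsilon=u_0\quad\text{a.e. on }B_R(0).$$ Then $u$ is the unique weak entropy solution of (B.1): every weak entropy solution $v$ of (B.1) satisfies $v=u$ a.e. on $[0,T]\times\mathbb R^d$. If moreover $t\mapsto u(t)$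 and $t\mapsto v(t)$ are right-continuous from $[0,T]$ into $L^1_{loc}(\mathbb R^d)$, then $v(t)=u(t)$ a.e. on $\mathbb R^d$ for every $t\in[0,T)$. -/

import Mathlib

open Set Filter Topology MeasureTheory
open scoped ContDiff ENNReal

noncomputable section

namespace ConservationLaw

/-- The space `ℝᵈ` with its Euclidean norm. -/
abbrev Space (d : ℕ) : Type := EuclideanSpace ℝ (Fin d)

/-- The partial gradient `∇f(t,x,u)` (derivative in the space variable `x` only) of a function of
`(t,x,u)`, as a linear map on `ℝᵈ`. -/
def gradX {d : ℕ} {V : Type*} [NormedAddCommGroup V] [NormedSpace ℝ V]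
    (h : ℝ → Space d → ℝ → V) (t : ℝ) (x : Space d) (u : ℝ) : Space d →L[ℝ] V :=
  fderiv ℝ (fun y => h t y u) x

/-- The partial derivative `∂ᵤf(t,x,u)` of a function of `(t,x,u)`. -/
def derivU {d : ℕ} {V : Type*} [NormedAddCommGroup V] [NormedSpace ℝ V]
    (h : ℝ → Space d → ℝ → V) (t : ℝ) (x : Space d) (u : ℝ) : V :=
  deriv (fun w => h t x w) u

/-- The partial divergence `div f(t,x,u) = ∑ₖ ∂_{xₖ} fᵏ(t,x,u)`, taken in `x` with `t`, `u` fixed. -/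
def divX {d : ℕ} (f : ℝ → Space d → ℝ → Space d) (t : ℝ) (x : Space d) (u : ℝ) : ℝ :=
  ∑ k : Fin d, (gradX f t x u (EuclideanSpace.single k 1)) k

/-- The function `F - div f`. -/
def excess {d : ℕ} (f : ℝ → Space d → ℝ → Space d) (F : ℝ → Space d → ℝ → ℝ)
    (t : ℝ) (x : Space d) (u : ℝ) : ℝ :=
  F t x u - divX f t x u

/-- `h` is continuous on `[0,T] × ℝᵈ × ℝ`. -/
def ContinuousOnSlab {d : ℕ} {V : Type*} [TopologicalSpace V] (T : ℝ)
    (h : ℝ → Space d → ℝ → V) : Prop :=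
  ContinuousOn (fun p : ℝ × Space d × ℝ => h p.1 p.2.1 p.2.2) (Icc 0 T ×ˢ univ)

/-- `h ∈ L^∞([0,T] × ℝᵈ × [-U,U])` for every `U > 0`. It is applied only to functions which are
continuous, for which the essential supremum is the supremum. -/
def BoundedOnSlab {d : ℕ} {V : Type*} [NormedAddCommGroup V] (T : ℝ)
    (h : ℝ → Space d → ℝ → V) : Prop :=
  ∀ U : ℝ, 0 < U → ∃ C : ℝ, ∀ t ∈ Icc (0 : ℝ) T, ∀ x : Space d, ∀ u ∈ Icc (-U) U, ‖h t x u‖ ≤ C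

/-- Condition (H1) on `[0,T]`: `f`, `F` are continuous, `∂ᵤf`, `∂ᵤ∇f`, `∇²f`, `∂ᵤF`, `∇F` exist and
are continuous, and `∂ᵤf`, `F - div f`, `∂ᵤ(F - div f)` are bounded on `[0,T] × ℝᵈ × [-U,U]`
for all `U > 0`. (Continuity of `∇f`, listed as `cont_gradX_f`, follows from continuity of `f`
and of `∇²f`.) -/
structure H1 {d : ℕ} (T : ℝ) (f : ℝ → Space d → ℝ → Space d) (F : ℝ → Space d → ℝ → ℝ) :
    Prop where
  cont_f : ContinuousOnSlab T f
  cont_F : ContinuousOnSlab T F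
  diff_u_f : ∀ t ∈ Icc (0 : ℝ) T, ∀ x u, DifferentiableAt ℝ (fun w => f t x w) u
  cont_derivU_f : ContinuousOnSlab T (derivU f)
  diff_x_f : ∀ t ∈ Icc (0 : ℝ) T, ∀ x u, DifferentiableAt ℝ (fun y => f t y u) x
  cont_gradX_f : ContinuousOnSlab T (gradX f)
  diff_u_gradX_f : ∀ t ∈ Icc (0 : ℝ) T, ∀ x u, DifferentiableAt ℝ (fun w => gradX f t x w) u
  cont_derivU_gradX_f : ContinuousOnSlab T (derivU (gradX f))
  diff_x_gradX_f : ∀ t ∈ Icc (0 : ℝ) T, ∀ x u, DifferentiableAt ℝ (fun y => gradX f t y u) x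
  cont_gradX_gradX_f : ContinuousOnSlab T (gradX (gradX f))
  diff_u_F : ∀ t ∈ Icc (0 : ℝ) T, ∀ x u, DifferentiableAt ℝ (fun w => F t x w) u
  cont_derivU_F : ContinuousOnSlab T (derivU F)
  diff_x_F : ∀ t ∈ Icc (0 : ℝ) T, ∀ x u, DifferentiableAt ℝ (fun y => F t y u) x
  cont_gradX_F : ContinuousOnSlab T (gradX F)
  bdd_derivU_f : BoundedOnSlab T (derivU f)
  bdd_excess : BoundedOnSlab T (excess f F)
  bdd_derivU_excess : BoundedOnSlab T (derivU (excess f F))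

/-- `∫₀ᵀ ∫_A ‖∇(F - div f)(t,x,·)‖_{L^∞([-U,U])} dx dt`, as an extended nonnegative real. -/
def excessGradIntegral {d : ℕ} (T : ℝ) (f : ℝ → Space d → ℝ → Space d)
    (F : ℝ → Space d → ℝ → ℝ) (A : Set (Space d)) (U : ℝ) : ℝ≥0∞ :=
  ∫⁻ t in Icc (0 : ℝ) T, ∫⁻ x in A, ⨆ u ∈ Icc (-U) U, ‖gradX (excess f F) t x u‖ₑ

/-- Condition (H2) on `[0,T]`. -/
structure H2 {d : ℕ} (T : ℝ) (f : ℝ → Space d → ℝ → Space d) (F : ℝ → Space d → ℝ → ℝ) :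
    Prop where
  bdd_gradX_derivU_f : BoundedOnSlab T (gradX (derivU f))
  bdd_derivU_F : BoundedOnSlab T (derivU F)
  integral_lt_top : ∀ U : ℝ, 0 < U → excessGradIntegral T f F univ U < ⊤

/-- Condition (H2*) on `[0,T]`, the localized version of (H2). -/
structure H2Star {d : ℕ} (T : ℝ) (f : ℝ → Space d → ℝ → Space d) (F : ℝ → Space d → ℝ → ℝ) :
    Prop where
  bdd_gradX_derivU_f : BoundedOnSlab T (gradX (derivU f))
  bdd_derivU_F : BoundedOnSlab T (derivU F)
  integral_lt_top : ∀ U R : ℝ, 0 < U → 0 < R →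
    excessGradIntegral T f F (Metric.ball 0 R) U < ⊤

/-- Lebesgue measure on `[0,T] × ℝᵈ`. -/
def slab (d : ℕ) (T : ℝ) : Measure (ℝ × Space d) :=
  volume.restrict (Icc (0 : ℝ) T ×ˢ univ)

/-- The integrand of the entropy inequality for the constant `k` and the test function `φ`;
`fderiv ℝ φ (t,x) (1,0) = ∂ₜφ(t,x)` and `fderiv ℝ φ (t,x) (0,w) = w · ∇φ(t,x)`. -/
def entropyIntegrand {d : ℕ} (f : ℝ → Space d → ℝ → Space d) (F : ℝ → Space d → ℝ → ℝ)
    (u : ℝ → Space d → ℝ) (k : ℝ) (φ : ℝ × Space d → ℝ) (t : ℝ) (x : Space d) : ℝ :=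
  |u t x - k| * fderiv ℝ φ (t, x) (1, 0)
    + Real.sign (u t x - k) * fderiv ℝ φ (t, x) (0, f t x (u t x) - f t x k)
    + Real.sign (u t x - k) * (F t x (u t x) - divX f t x k) * φ (t, x)

/-- `u ∈ L^∞([0,T] × ℝᵈ)` is a weak entropy solution of `∂ₜu + Div f(t,x,u) = F(t,x,u)`,
`u(0) = u₀`. The function `u` is a representative of its class; the notion does not depend on the
representative, because the exceptional null set of times in `initial` may be enlarged. -/
structure IsWeakEntropySolution {d : ℕ} (T : ℝ) (f : ℝ → Space d → ℝ → Space d)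
    (F : ℝ → Space d → ℝ → ℝ) (u₀ : Space d → ℝ) (u : ℝ → Space d → ℝ) : Prop where
  memLp : MemLp (fun p : ℝ × Space d => u p.1 p.2) ⊤ (slab d T)
  entropy : ∀ k : ℝ, ∀ φ : ℝ × Space d → ℝ, ContDiff ℝ ∞ φ → HasCompactSupport φ →
    tsupport φ ⊆ Ioo (0 : ℝ) T ×ˢ univ → (∀ p, 0 ≤ φ p) →
    0 ≤ ∫ p, entropyIntegrand f F u k φ p.1 p.2 ∂(slab d T)
  initial : ∃ N : Set ℝ, N ⊆ Icc 0 T ∧ volume N = 0 ∧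
    (∀ t ∈ Icc (0 : ℝ) T \ N, AEStronglyMeasurable (u t) volume) ∧
    ∀ r : ℝ, 0 < r →
      Tendsto (fun t => ∫⁻ x in Metric.ball (0 : Space d) r, ‖u t x - u₀ x‖ₑ)
        (𝓝[Ioc 0 T \ N] 0) (𝓝 0)

/-- `t ↦ u(t)` is right-continuous from `[0,T]` into `L¹_loc(ℝᵈ)`. -/
def RightContinuousL1loc {d : ℕ} (T : ℝ) (u : ℝ → Space d → ℝ) : Prop :=
  (∀ t ∈ Icc (0 : ℝ) T, LocallyIntegrable (u t) volume) ∧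
  ∀ t ∈ Icc (0 : ℝ) T, ∀ r : ℝ, 0 < r →
    Tendsto (fun s => ∫⁻ x in Metric.ball (0 : Space d) r, ‖u s x - u t x‖ₑ)
      (𝓝[Ioc t T] t) (𝓝 0)

/-- `u^ε → u` in `L¹([0,T]; L¹_loc(ℝᵈ))` as `ε → 0`, `ε > 0`. -/
def TendstoL1L1loc {d : ℕ} (T : ℝ) (uε : ℝ → ℝ → Space d → ℝ) (u : ℝ → Space d → ℝ) : Prop :=
  ∀ r : ℝ, 0 < r →
    Tendsto (fun ε => ∫⁻ p in Icc (0 : ℝ) T ×ˢ Metric.ball (0 : Space d) r,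
      ‖uε ε p.1 p.2 - u p.1 p.2‖ₑ) (𝓝[>] 0) (𝓝 0)

end ConservationLaw

end

open Set Filter Topology MeasureTheory
open scoped ContDiff ENNReal

noncomputable section

namespace ConservationLaw

/-! The proof is Kružkov's uniqueness argument, applied to `u` and a second solution `v` with the
same initial datum. After replacing both by bounded measurable representatives, with a common bound
`C`, everything takes place on `[-C,C]`, where the bound on `∂ᵤf` makes `f` Lipschitz in `u` with a
constant `M` (the speed of propagation) and the bound on `∂ᵤF` makes `F` Lipschitz with a constant
`L`, uniformly in `(t,x)`.

The entropy inequality for `u` at `p`, with `k = v q`, is added to that for `v` at `q`, with `k = u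
p`, using the test function `ψ p * κ (S⁻¹ (p - q))`. In the sum the time derivative of `κ` cancels,
and `∇κ` meets the flux only through the increments `f p c - f q c` at a fixed value `c`. Since `f`
is merely continuous in time, `S` is anisotropic: the time scale `τ` is taken so small relative to
the space scale `h` that the time increment of `f` is at most `h²`. The quotients by `h` then
converge to `∇f(p,c) z`. Integrating `∇κ` against this linear field gives minus its trace, that is,
minus the divergence, and this cancels the divergence terms in the entropy inequalities. What
remains is the Kato type inequality `ContinuousFlux.integral_kato_nonneg`.

That inequality is tested with a smooth weight on a backward cone of slope `M` with decay `exp (-(L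
+ 1) t)`. The slope absorbs the flux difference, the rate `L` absorbs the source, and the surplus
`1` leaves a bound of the weighted distance between `u` and `v` by an average of it over a thin
layer near `t = 0` (`ContinuousFlux.integral_coneTest_le`). This average tends to zero because both
solutions attain the same initial datum in `L¹_loc`, so `u = v` almost everywhere
(`ContinuousFlux.ae_eq_of_isEntropic`, `IsWeakEntropySolution.ae_eq`). Equality at every time before
`T` follows because the good times are dense and both curves are right-continuous
(`RightContinuousL1loc.ae_eq`). -/

section General

/-! ### Haar measure: linear changes of variables and small translations. -/

variable {E : Type*} [NormedAddCommGroup E] [NormedSpace ℝ E] [FiniteDimensional ℝ E]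
  [MeasurableSpace E] [BorelSpace E] (μ : Measure E) [μ.IsAddHaarMeasure]

theorem map_continuousLinearEquiv_eq_smul (L : E ≃L[ℝ] E) :
    ∃ c : ℝ≥0∞, Measure.map L μ = c • μ := by
  have hdet : LinearMap.det (L.toLinearEquiv : E →ₗ[ℝ] E) ≠ 0 :=
    (LinearEquiv.isUnit_det' L.toLinearEquiv).ne_zero
  exact ⟨_, Measure.map_linearMap_addHaar_eq_smul_addHaar μ hdet⟩

/-- The Jacobian is constant, so a linear change of variables preserves the sign of an integral.
Only signs matter in the doubling argument, so the kernel never has to be normalized by the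
determinant. -/
theorem integral_comp_continuousLinearEquiv_nonneg (L : E ≃L[ℝ] E) {G : E → ℝ}
    (h : 0 ≤ ∫ z, G z ∂μ) : 0 ≤ ∫ z, G (L z) ∂μ := by
  obtain ⟨c, hc⟩ := map_continuousLinearEquiv_eq_smul μ L
  have := L.toHomeomorph.measurableEmbedding.integral_map (μ := μ) G
  have h2 : ∫ z, G (L z) ∂μ = ∫ z, G z ∂(Measure.map L μ) := this.symm
  rw [h2, hc, integral_smul_measure]
  exact mul_nonneg ENNReal.toReal_nonneg h

theorem tendsto_lintegral_translate {v : E → ℝ} (hv : Integrable v μ) {ι : Type*} {l : Filter ι}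
    {a : ι → E} (ha : Tendsto a l (𝓝 0)) :
    Tendsto (fun i => ∫⁻ p, ‖v (p - a i) - v p‖ₑ ∂μ) l (𝓝 0) := by
  -- Currying subtraction makes `b ↦ (· - b)` continuous into the compact-open topology, as needed
  -- for continuity of composition in `L¹`.
  let G : C(E, C(E, E)) := (ContinuousMap.mk (fun z : E × E => z.2 - z.1) (by fun_prop)).curry
  have hmp : ∀ b, MeasurePreserving (G b) μ μ := fun b => measurePreserving_sub_right μ b
  have hv' : MemLp v 1 μ := memLp_one_iff_integrable.2 hv
  have key := Filter.Tendsto.compMeasurePreservingLp (μ := μ) (ν := μ) (p := 1) (l := l)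
    (f := fun _ => hv'.toLp v) (f₀ := hv'.toLp v) (g := fun i => G (a i)) (g₀ := G 0)
    tendsto_const_nhds ((G.continuous.tendsto 0).comp ha) (fun i => hmp (a i)) (hmp 0)
    ENNReal.one_ne_top
  rw [tendsto_iff_edist_tendsto_0] at key
  refine key.congr fun i => ?_
  rw [Lp.edist_def, eLpNorm_one_eq_lintegral_enorm]
  refine lintegral_congr_ae ?_
  have e1 := Lp.coeFn_compMeasurePreserving (hv'.toLp v) (hmp (a i))
  have e2 := Lp.coeFn_compMeasurePreserving (hv'.toLp v) (hmp 0)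
  have e3 := (hmp (a i)).quasiMeasurePreserving.ae_eq_comp hv'.coeFn_toLp
  have e4 := (hmp 0).quasiMeasurePreserving.ae_eq_comp hv'.coeFn_toLp
  filter_upwards [e1, e2, e3, e4] with p h1 h2 h3 h4
  simp only [Pi.sub_apply]
  rw [h1, h2, h3, h4]
  simp [G]

/-- For each fixed `ζ` the translates converge in `L¹`; dominated convergence in `ζ` gives
convergence in `L¹` of the product, hence in measure, hence almost everywhere along a subsequence.
This stands in for a Lebesgue point argument and imposes no relation between the time and space
scales of `S n`. -/
theorem exists_subseq_ae_tendsto_translate {v : E → ℝ} (hv : Measurable v) {C : ℝ}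
    (hC : ∀ p, |v p| ≤ C) {S : ℕ → E → E} (hSm : ∀ n, Measurable (S n))
    (hS : ∀ ζ, Tendsto (fun n => S n ζ) atTop (𝓝 0)) (R : ℝ) :
    ∃ φ : ℕ → ℕ, StrictMono φ ∧
      ∀ᵐ z ∂((μ.restrict (Metric.closedBall 0 R)).prod (μ.restrict (Metric.closedBall 0 R))),
        Tendsto (fun n => v (z.1 - S (φ n) z.2)) atTop (𝓝 (v z.1)) := by
  set B := Metric.closedBall (0 : E) R with hB
  -- The margin `1` keeps `p - S n ζ` inside the truncation for all large `n`, so cutting `v` off to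
  -- make it integrable does not affect the limit.
  set B' := Metric.closedBall (0 : E) (R + 1) with hB'
  have hBc : μ B' < ⊤ := (isCompact_closedBall _ _).measure_lt_top
  have hBc1 : μ B < ⊤ := (isCompact_closedBall _ _).measure_lt_top
  have : IsFiniteMeasure (μ.restrict B) := ⟨by simpa using hBc1⟩
  have hmB' : MeasurableSet B' := Metric.isClosed_closedBall.measurableSet
  have hmB : MeasurableSet B := Metric.isClosed_closedBall.measurableSet
  set w : E → ℝ := B'.indicator v with hw
  have hwm : Measurable w := hv.indicator hmB'
  have hwi : Integrable w μ := by
    rw [hw, integrable_indicator_iff hmB']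
    refine Measure.integrableOn_of_bounded (M := C) hBc.ne hv.aestronglyMeasurable ?_
    exact Eventually.of_forall fun p => by simpa using hC p
  have hmeas : ∀ n, Measurable fun z : E × E => w (z.1 - S n z.2) - w z.1 := fun n =>
    (hwm.comp (measurable_fst.sub ((hSm n).comp measurable_snd))).sub (hwm.comp measurable_fst)
  have htend : Tendsto (fun n => ∫⁻ z, ‖w (z.1 - S n z.2) - w z.1‖ₑ
      ∂((μ.restrict B).prod (μ.restrict B))) atTop (𝓝 0) := by
    have e : ∀ n, ∫⁻ z, ‖w (z.1 - S n z.2) - w z.1‖ₑ ∂((μ.restrict B).prod (μ.restrict B)) =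
        ∫⁻ ζ in B, ∫⁻ p in B, ‖w (p - S n ζ) - w p‖ₑ ∂μ ∂μ := fun n =>
      lintegral_prod_symm' _ (hmeas n).enorm
    simp_rw [e]
    have := tendsto_lintegral_of_dominated_convergence (μ := μ.restrict B)
      (F := fun n ζ => ∫⁻ p in B, ‖w (p - S n ζ) - w p‖ₑ ∂μ) (f := fun _ => 0)
      (fun _ => ENNReal.ofReal (2 * C) * μ B)
      (fun n => (hmeas n).enorm.lintegral_prod_left' ) ?_ ?_ ?_
    · simpa using this
    · intro n
      refine Eventually.of_forall fun ζ => ?_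
      calc ∫⁻ p in B, ‖w (p - S n ζ) - w p‖ₑ ∂μ ≤ ∫⁻ p in B, ENNReal.ofReal (2 * C) ∂μ := by
            refine lintegral_mono fun p => ?_
            rw [Real.enorm_eq_ofReal_abs]
            refine ENNReal.ofReal_le_ofReal ?_
            have hw' : ∀ q, |w q| ≤ C := fun q => by
              by_cases hq : q ∈ B'
              · simpa [hw, hq] using hC q
              · simpa [hw, hq] using (abs_nonneg _).trans (hC q)
            calc _ ≤ |w (p - S n ζ)| + |w p| := abs_sub _ _
              _ ≤ 2 * C := by linarith [hw' (p - S n ζ), hw' p]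
        _ = _ := by simp
    · simp only [lintegral_const, Measure.restrict_apply MeasurableSet.univ, univ_inter]
      exact (ENNReal.mul_lt_top (ENNReal.mul_lt_top ENNReal.ofReal_lt_top hBc1) hBc1).ne
    · refine Eventually.of_forall fun ζ => ?_
      refine tendsto_of_tendsto_of_tendsto_of_le_of_le tendsto_const_nhds
        (tendsto_lintegral_translate μ hwi (hS ζ)) (fun n => zero_le)
        (fun n => setLIntegral_le_lintegral _ _)
  have hmes : TendstoInMeasure ((μ.restrict B).prod (μ.restrict B))
      (fun n (z : E × E) => w (z.1 - S n z.2) - w z.1) atTop (fun _ => 0) := by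
    refine tendstoInMeasure_of_tendsto_eLpNorm (p := 1) one_ne_zero
      (fun n => (hmeas n).aestronglyMeasurable) aestronglyMeasurable_const ?_
    simpa [eLpNorm_one_eq_lintegral_enorm, Pi.sub_def] using htend
  obtain ⟨φ, hφ, hae⟩ := hmes.exists_seq_tendsto_ae
  refine ⟨φ, hφ, ?_⟩
  have hmem : ∀ᵐ z ∂((μ.restrict B).prod (μ.restrict B)), z.1 ∈ B := by
    rw [Measure.prod_restrict]
    filter_upwards [ae_restrict_mem (hmB.prod hmB)] with z hz using hz.1
  filter_upwards [hae, hmem] with z hz hzB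
  have h1 : Tendsto (fun n => w (z.1 - S (φ n) z.2)) atTop (𝓝 (w z.1)) := by
    simpa using hz.add_const (w z.1)
  have hz1 : z.1 ∈ B' := Metric.closedBall_subset_closedBall (by linarith) hzB
  rw [hw, indicator_of_mem hz1] at h1
  refine h1.congr' ?_
  have := ((hS z.2).comp hφ.tendsto_atTop).norm
  rw [norm_zero] at this
  filter_upwards [this.eventually_lt_const zero_lt_one] with n hn
  refine indicator_of_mem ?_ _
  rw [hB', mem_closedBall_zero_iff]
  rw [hB, mem_closedBall_zero_iff] at hzB
  have : ‖S (φ n) z.2‖ < 1 := hn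
  linarith [norm_sub_le z.1 (S (φ n) z.2)]

end General

/-! ### The sign function and integrability of doubled integrands. -/

section

theorem abs_sign_le_one (r : ℝ) : |Real.sign r| ≤ 1 := by
  rcases Real.sign_apply_eq r with h | h | h <;> simp [h]

theorem sign_mul_self_eq_abs (r : ℝ) : Real.sign r * r = |r| := by
  rcases lt_trichotomy r 0 with h | h | h
  · rw [Real.sign_of_neg h, abs_of_neg h, neg_one_mul]
  · simp [h]
  · rw [Real.sign_of_pos h, abs_of_pos h, one_mul]

theorem measurable_sign : Measurable Real.sign := by
  unfold Real.sign
  exact Measurable.ite measurableSet_Iio measurable_const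
    (Measurable.ite measurableSet_Ioi measurable_const measurable_const)

/-- The sign jumps only at zero, and there the other factor tends to zero by `h`. This is how the
limit of the doubled inequality passes through the set where the two solutions coincide. -/
theorem tendsto_sign_mul {ι : Type*} {l : Filter ι} {s y : ι → ℝ} {s₀ y₀ : ℝ}
    (hs : Tendsto s l (𝓝 s₀)) (hy : Tendsto y l (𝓝 y₀)) (h : s₀ = 0 → y₀ = 0) :
    Tendsto (fun i => Real.sign (s i) * y i) l (𝓝 (Real.sign s₀ * y₀)) := by
  rcases lt_trichotomy s₀ 0 with h0 | h0 | h0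
  · refine Tendsto.mul ?_ hy
    refine tendsto_const_nhds.congr' ?_
    filter_upwards [hs.eventually_lt_const h0] with i hi
    rw [Real.sign_of_neg h0, Real.sign_of_neg hi]
  · rw [h h0, mul_zero]
    rw [h h0] at hy
    refine squeeze_zero_norm (fun i => ?_) (by simpa using hy.norm)
    rw [norm_mul]
    exact mul_le_of_le_one_left (norm_nonneg _) (abs_sign_le_one _)
  · refine Tendsto.mul ?_ hy
    refine tendsto_const_nhds.congr' ?_
    filter_upwards [hs.eventually_const_lt h0] with i hi
    rw [Real.sign_of_pos h0, Real.sign_of_pos hi]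

theorem integrable_sign_mul {X : Type*} [TopologicalSpace X] [SecondCountableTopology X] [T2Space X]
    [MeasurableSpace X] [BorelSpace X] (μ : Measure X) [IsFiniteMeasureOnCompacts μ]
    {G : X → ℝ → ℝ → ℝ} (hG : Continuous fun z : X × ℝ × ℝ => G z.1 z.2.1 z.2.2)
    {K : Set X} (hK : IsCompact K) (hGK : ∀ x, x ∉ K → ∀ a b, G x a b = 0)
    {U V : X → ℝ} (hU : Measurable U) (hV : Measurable V) {C : ℝ}
    (hUC : ∀ x, |U x| ≤ C) (hVC : ∀ x, |V x| ≤ C) :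
    Integrable (fun x => Real.sign (U x - V x) * G x (U x) (V x)) μ := by
  obtain ⟨M, hM⟩ := ((hK.prod ((isCompact_Icc (a := -C) (b := C)).prod
    (isCompact_Icc (a := -C) (b := C)))).bddAbove_image hG.norm.continuousOn)
  have hmeas : Measurable fun x => Real.sign (U x - V x) * G x (U x) (V x) :=
    (measurable_sign.comp (hU.sub hV)).mul
      (hG.measurable.comp (measurable_id.prodMk (hU.prodMk hV)))
  rw [← integrableOn_iff_integrable_of_support_subset (s := K)]
  · refine Measure.integrableOn_of_bounded (M := M) hK.measure_lt_top.ne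
      hmeas.aestronglyMeasurable ?_
    refine (ae_restrict_iff' hK.measurableSet).2 (Eventually.of_forall fun x hx => ?_)
    rw [norm_mul]
    refine (mul_le_of_le_one_left (norm_nonneg _) (abs_sign_le_one _)).trans ?_
    exact hM ⟨(x, U x, V x), ⟨hx, abs_le.1 (hUC x), abs_le.1 (hVC x)⟩, rfl⟩
  · intro x hx
    by_contra hxK
    exact hx (by simp [hGK x hxK])

/-! ### Integration by parts against a linear vector field. -/

variable {d : ℕ}

/-- The trace of an endomorphism of `ℝᵈ`, computed in the standard basis. -/
def diagSum (B : Space d →L[ℝ] Space d) : ℝ := ∑ k, (B (EuclideanSpace.single k 1)) k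

@[fun_prop]
theorem continuous_diagSum : Continuous (diagSum (d := d)) := by
  unfold diagSum
  fun_prop

theorem diagSum_sub (A B : Space d →L[ℝ] Space d) : diagSum (A - B) = diagSum A - diagSum B := by
  simp [diagSum, Finset.sum_sub_distrib]

instance isAddHaarMeasure_volume_spacetime :
    (volume : Measure (ℝ × Space d)).IsAddHaarMeasure := by
  rw [Measure.volume_eq_prod]
  infer_instance

/-- The divergence of the field `z ↦ B z` is the constant `diagSum B`. This identity lets the
difference quotients of the flux cancel the divergence terms after the limit. -/
theorem integral_fderiv_linear_field {κ : ℝ × Space d → ℝ} (hκ : ContDiff ℝ ∞ κ)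
    (hc : HasCompactSupport κ) (B : Space d →L[ℝ] Space d) :
    ∫ ζ, fderiv ℝ κ ζ (0, B ζ.2) = -(diagSum B * ∫ ζ, κ ζ) := by
  have hκ' : Continuous (fderiv ℝ κ) := hκ.continuous_fderiv (by simp)
  have hc' : HasCompactSupport (fderiv ℝ κ) := hc.fderiv ℝ
  set e : Fin d → ℝ × Space d := fun k => (0, B (EuclideanSpace.single k 1)) with he
  have hexp : ∀ ζ : ℝ × Space d, fderiv ℝ κ ζ (0, B ζ.2) = ∑ k, ζ.2 k * fderiv ℝ κ ζ (e k) := by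
    intro ζ
    have h1 : ζ.2 = ∑ k, ζ.2 k • EuclideanSpace.single k (1 : ℝ) := by
      ext i
      simp [Pi.single_apply]
    have h2 : ((0 : ℝ), B ζ.2) = ∑ k, ζ.2 k • e k := by
      conv_lhs => rw [h1]
      ext1
      · simp [he, Prod.fst_sum]
      · simp [he, Prod.snd_sum]
    rw [h2]
    simp
  have hcoord : ∀ k, ContDiff ℝ ∞ fun ζ : ℝ × Space d => ζ.2 k := fun k => by fun_prop
  have hi : ∀ k, Integrable fun ζ : ℝ × Space d => ζ.2 k * fderiv ℝ κ ζ (e k) := fun k => by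
    refine Continuous.integrable_of_hasCompactSupport ?_ ?_
    · exact (hcoord k).continuous.mul (hκ'.clm_apply continuous_const)
    · refine HasCompactSupport.mul_left ?_
      exact hc'.comp_left (g := fun ℓ : ℝ × Space d →L[ℝ] ℝ => ℓ (e k)) rfl
  have hder : ∀ k, ∀ ζ : ℝ × Space d, fderiv ℝ (fun ζ : ℝ × Space d => ζ.2 k) ζ (e k) = (e k).2 k := by
    intro k ζ
    have : HasFDerivAt (fun ζ : ℝ × Space d => ζ.2 k)
      ((EuclideanSpace.proj k : Space d →L[ℝ] ℝ).comp (ContinuousLinearMap.snd ℝ ℝ (Space d))) ζ :=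
      ((EuclideanSpace.proj k : Space d →L[ℝ] ℝ).comp
        (ContinuousLinearMap.snd ℝ ℝ (Space d))).hasFDerivAt
    rw [this.fderiv]
    rfl
  simp_rw [hexp]
  rw [integral_finsetSum _ fun k _ => hi k, diagSum, Finset.sum_mul, ← Finset.sum_neg_distrib]
  refine Finset.sum_congr rfl fun k _ => ?_
  rw [integral_mul_fderiv_eq_neg_fderiv_mul_of_integrable]
  · simp_rw [hder]
    rw [integral_const_mul]
  · simp_rw [hder]
    exact (hκ.continuous.integrable_of_hasCompactSupport hc).const_mul _
  · exact hi k
  · exact ((hcoord k).continuous.mul hκ.continuous).integrable_of_hasCompactSupport hc.mul_left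
  · exact fun ζ _ => ((hcoord k).differentiable (by simp)).differentiableAt
  · exact fun ζ _ => (hκ.differentiable (by simp)).differentiableAt

/-- Coefficients on `ℝ × ℝᵈ × ℝ`: the flux `f`, its spatial gradient `g`, and the source `F`, all
jointly continuous. -/
structure ContinuousFlux (f : ℝ × Space d → ℝ → Space d)
    (g : ℝ × Space d → ℝ → Space d →L[ℝ] Space d) (F : ℝ × Space d → ℝ → ℝ) : Prop where
  cont_f : Continuous fun z : (ℝ × Space d) × ℝ => f z.1 z.2
  cont_g : Continuous fun z : (ℝ × Space d) × ℝ => g z.1 z.2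
  cont_F : Continuous fun z : (ℝ × Space d) × ℝ => F z.1 z.2
  hasFDerivAt : ∀ t x w, HasFDerivAt (fun y => f (t, y) w) (g (t, x) w) x

/-! ### Difference quotients of the flux. -/

section Quotient

variable {f : ℝ × Space d → ℝ → Space d} {g : ℝ × Space d → ℝ → Space d →L[ℝ] Space d}
  {F : ℝ × Space d → ℝ → ℝ}

theorem ContinuousFlux.norm_sub_sub_le (hc : ContinuousFlux f g F) {t c ε : ℝ} {x : Space d}
    {A : Space d →L[ℝ] Space d} {s : Set (Space d)} (hs : Convex ℝ s)
    (hA : ∀ y ∈ s, ‖g (t, y) c - A‖ ≤ ε) {y : Space d} (hx : x ∈ s) (hy : x - y ∈ s) :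
    ‖f (t, x) c - f (t, x - y) c - A y‖ ≤ ε * ‖y‖ := by
  have := hs.norm_image_sub_le_of_norm_hasFDerivWithin_le' (f := fun y => f (t, y) c)
    (f' := fun y => g (t, y) c) (φ := A) (C := ε)
    (fun y _ => (hc.hasFDerivAt t y c).hasFDerivWithinAt) hA hy hx
  simpa using this

/-- The spatial increment is handled by the mean value inequality, with `g` close to `g p c₀` near
`(p, c₀)`; joint continuity of `g` allows the value `c n` to vary. The time increment is at most `h
n ^ 2`, hence still negligible after division by `h n`. -/
theorem ContinuousFlux.tendsto_quotient (hc : ContinuousFlux f g F) {p : ℝ × Space d}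
    {z : Space d} {c₀ : ℝ} {c h s : ℕ → ℝ} (hcn : Tendsto c atTop (𝓝 c₀))
    (hh : ∀ n, 0 < h n) (hh0 : Tendsto h atTop (𝓝 0))
    (hs : ∀ n, ‖f (p.1, p.2 - h n • z) (c n) - f (s n, p.2 - h n • z) (c n)‖ ≤ h n ^ 2) :
    Tendsto (fun n => (h n)⁻¹ • (f p (c n) - f (s n, p.2 - h n • z) (c n))) atTop
      (𝓝 (g p c₀ z)) := by
  have h1 : Tendsto (fun n => (h n)⁻¹ • (f p (c n) - f (p.1, p.2 - h n • z) (c n))) atTop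
      (𝓝 (g p c₀ z)) := by
    rw [Metric.tendsto_nhds]
    intro ε hε
    have hz : 0 < ‖z‖ + 1 := by positivity
    obtain ⟨δ, hδ, hδg⟩ := Metric.continuous_iff.1 hc.cont_g (p, c₀) (ε / (‖z‖ + 1))
      (div_pos hε hz)
    have hhz : Tendsto (fun n => h n • z) atTop (𝓝 0) := by
      simpa using hh0.smul_const z
    filter_upwards [Metric.tendsto_nhds.1 hcn δ hδ, Metric.tendsto_nhds.1 hhz δ hδ] with n hn hn'
    have key := hc.norm_sub_sub_le (t := p.1) (c := c n) (ε := ε / (‖z‖ + 1)) (x := p.2)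
      (A := g p c₀) (y := h n • z) (convex_ball p.2 δ) (fun y hy => by
        have := hδg ((p.1, y), c n) (by
          rw [Prod.dist_eq, max_lt_iff, Prod.dist_eq, max_lt_iff]
          exact ⟨⟨by simpa using hδ, hy⟩, hn⟩)
        rw [dist_eq_norm] at this
        exact this.le) (Metric.mem_ball_self hδ) (by
          rw [Metric.mem_ball, dist_eq_norm]
          simpa using hn')
    rw [map_smul, norm_smul, Real.norm_of_nonneg (hh n).le] at key
    rw [dist_eq_norm]
    have e : (h n)⁻¹ • (f p (c n) - f (p.1, p.2 - h n • z) (c n)) - g p c₀ z =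
        (h n)⁻¹ • (f (p.1, p.2) (c n) - f (p.1, p.2 - h n • z) (c n) - h n • g p c₀ z) := by
      rw [smul_sub _ _ (h n • _), smul_smul, inv_mul_cancel₀ (hh n).ne', one_smul]
    rw [e, norm_smul, norm_inv, Real.norm_of_nonneg (hh n).le, inv_mul_lt_iff₀ (hh n)]
    refine key.trans_lt ?_
    rw [mul_left_comm]
    refine mul_lt_mul_of_pos_left ?_ (hh n)
    rw [div_mul_eq_mul_div, div_lt_iff₀ hz]
    nlinarith
  have h2 : Tendsto (fun n => (h n)⁻¹ • (f (p.1, p.2 - h n • z) (c n)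
      - f (s n, p.2 - h n • z) (c n))) atTop (𝓝 0) := by
    refine squeeze_zero_norm (fun n => ?_) hh0
    rw [norm_smul, norm_inv, Real.norm_of_nonneg (hh n).le, inv_mul_le_iff₀ (hh n), ← sq]
    exact hs n
  simpa [← smul_add] using h1.add h2

theorem ContinuousFlux.norm_quotient_le (hc : ContinuousFlux f g F) {p : ℝ × Space d}
    {z : Space d} {c h s M r : ℝ} (hh : 0 < h)
    (hM : ∀ y ∈ Metric.closedBall (0 : Space d) r, ‖g (p.1, y) c‖ ≤ M)
    (hp : p.2 ∈ Metric.closedBall 0 r) (hp' : p.2 - h • z ∈ Metric.closedBall 0 r)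
    (hs : ‖f (p.1, p.2 - h • z) c - f (s, p.2 - h • z) c‖ ≤ h ^ 2) :
    ‖h⁻¹ • (f p c - f (s, p.2 - h • z) c)‖ ≤ M * ‖z‖ + h := by
  have key := hc.norm_sub_sub_le (t := p.1) (c := c) (ε := M) (x := p.2)
      (A := 0) (y := h • z) (convex_closedBall 0 r) (by simpa using hM) hp hp'
  rw [zero_apply, sub_zero, norm_smul, Real.norm_of_nonneg hh.le] at key
  rw [norm_smul, norm_inv, Real.norm_of_nonneg hh.le, inv_mul_le_iff₀ hh]
  calc _ ≤ ‖f (p.1, p.2) c - f (p.1, p.2 - h • z) c‖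
        + ‖f (p.1, p.2 - h • z) c - f (s, p.2 - h • z) c‖ := norm_sub_le_norm_sub_add_norm_sub _ _ _
    _ ≤ M * (h * ‖z‖) + h ^ 2 := add_le_add key hs
    _ = _ := by ring

/-- Uniform continuity of `f` on a compact set; no rate in time is available, so the time scale has
to be adapted to it. -/
theorem ContinuousFlux.exists_time_modulus (hc : ContinuousFlux f g F) (r C : ℝ) {ε : ℝ}
    (hε : 0 < ε) : ∃ τ > 0, ∀ t s : ℝ, ∀ y : Space d, ∀ c : ℝ, |t| ≤ r → |s| ≤ r → ‖y‖ ≤ r →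
      |c| ≤ C → |t - s| ≤ τ → ‖f (t, y) c - f (s, y) c‖ ≤ ε := by
  have hK : IsCompact (Metric.closedBall (0 : ℝ × Space d) r ×ˢ Metric.closedBall (0 : ℝ) C) :=
    (isCompact_closedBall _ _).prod (isCompact_closedBall _ _)
  obtain ⟨δ, hδ, h⟩ := Metric.uniformContinuousOn_iff.1
    (hK.uniformContinuousOn_of_continuous hc.cont_f.continuousOn) ε hε
  refine ⟨δ / 2, by positivity, fun t s y c ht hs hy hC hts => ?_⟩
  have := h ((t, y), c) ?_ ((s, y), c) ?_ ?_
  · rw [dist_eq_norm] at this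
    exact this.le
  · simp [Prod.norm_def, ht, hy, hC]
  · simp [Prod.norm_def, hs, hy, hC]
  · simp only [Prod.dist_eq, dist_self, max_lt_iff, Real.dist_eq]
    exact ⟨⟨by linarith, hδ⟩, hδ⟩

end Quotient

end

/-! ### Doubling of variables. -/

section

variable {d : ℕ}

/-- The integrand of the Kružkov inequality at the point `p`, up to the factor `sgn (a - k)`, for a
solution with value `a` and a test function with value `c` and derivative `ℓ` at `p`. -/
def kruzkovForm (f : ℝ × Space d → ℝ → Space d) (g : ℝ × Space d → ℝ → Space d →L[ℝ] Space d)
    (F : ℝ × Space d → ℝ → ℝ) (p : ℝ × Space d) (a k c : ℝ) (ℓ : ℝ × Space d →L[ℝ] ℝ) : ℝ :=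
  (a - k) * ℓ (1, 0) + ℓ (0, f p a - f p k) + (F p a - diagSum (g p k)) * c

/-- `φ` is an admissible test function on `(0,T) × ℝᵈ`. -/
structure IsTestFunction (T : ℝ) (φ : ℝ × Space d → ℝ) : Prop where
  contDiff : ContDiff ℝ ∞ φ
  hasCompactSupport : HasCompactSupport φ
  tsupport_subset : tsupport φ ⊆ Ioo (0 : ℝ) T ×ˢ univ
  nonneg : ∀ p, 0 ≤ φ p

/-- The entropy inequalities, on the whole of `ℝ × ℝᵈ`. -/
def IsEntropic (T : ℝ) (f : ℝ × Space d → ℝ → Space d)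
    (g : ℝ × Space d → ℝ → Space d →L[ℝ] Space d) (F : ℝ × Space d → ℝ → ℝ)
    (u : ℝ × Space d → ℝ) : Prop :=
  ∀ k : ℝ, ∀ φ : ℝ × Space d → ℝ, IsTestFunction T φ →
    0 ≤ ∫ p, Real.sign (u p - k) * kruzkovForm f g F p (u p) k (φ p) (fderiv ℝ φ p)

/-- The change of variables `(p, ζ) ↦ (p, p - S ζ)`. -/
def shear {E : Type*} [NormedAddCommGroup E] [NormedSpace ℝ E] (S : E ≃L[ℝ] E) :
    (E × E) ≃L[ℝ] (E × E) :=
  ContinuousLinearEquiv.equivOfInverse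
    ((ContinuousLinearMap.fst ℝ E E).prod
      (ContinuousLinearMap.fst ℝ E E - (S : E →L[ℝ] E).comp (ContinuousLinearMap.snd ℝ E E)))
    ((ContinuousLinearMap.fst ℝ E E).prod
      ((S.symm : E →L[ℝ] E).comp (ContinuousLinearMap.fst ℝ E E - ContinuousLinearMap.snd ℝ E E)))
    (fun z => by simp) (fun z => by simp)

theorem shear_apply {E : Type*} [NormedAddCommGroup E] [NormedSpace ℝ E] (S : E ≃L[ℝ] E)
    (z : E × E) : shear S z = (z.1, z.1 - S z.2) := rfl

instance isAddHaarMeasure_volume_spacetime_prod :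
    (volume : Measure ((ℝ × Space d) × (ℝ × Space d))).IsAddHaarMeasure := by
  rw [Measure.volume_eq_prod]
  exact Measure.prod.instIsAddHaarMeasure _ _

section Doubling

variable {f : ℝ × Space d → ℝ → Space d} {g : ℝ × Space d → ℝ → Space d →L[ℝ] Space d}
  {F : ℝ × Space d → ℝ → ℝ} {T C : ℝ} {u v : ℝ × Space d → ℝ} {ψ κ : ℝ × Space d → ℝ}

theorem ContinuousFlux.continuous_kruzkovForm (hc : ContinuousFlux f g F) {X : Type*}
    [TopologicalSpace X] {p : X → ℝ × Space d} {a k c : X → ℝ} {ℓ : X → ℝ × Space d →L[ℝ] ℝ}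
    (hp : Continuous p) (ha : Continuous a) (hk : Continuous k) (hcc : Continuous c)
    (hl : Continuous ℓ) : Continuous fun x => kruzkovForm f g F (p x) (a x) (k x) (c x) (ℓ x) := by
  have h1 : Continuous fun x => f (p x) (a x) := hc.cont_f.comp (hp.prodMk ha)
  have h2 : Continuous fun x => f (p x) (k x) := hc.cont_f.comp (hp.prodMk hk)
  have h3 : Continuous fun x => F (p x) (a x) := hc.cont_F.comp (hp.prodMk ha)
  have h4 : Continuous fun x => g (p x) (k x) := hc.cont_g.comp (hp.prodMk hk)
  have h5 : Continuous fun x => ℓ x (1, 0) := hl.clm_apply continuous_const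
  have h6 : Continuous fun x => ℓ x (0, f (p x) (a x) - f (p x) (k x)) :=
    hl.clm_apply (continuous_const.prodMk (h1.sub h2))
  exact (((ha.sub hk).mul h5).add h6).add ((h3.sub (continuous_diagSum.comp h4)).mul hcc)

/-- The integrand obtained by doubling the variables with the test function
`ψ p * κ (S⁻¹ (p - q))`, in the variables `p` and `ζ = S⁻¹ (p - q)`, up to the factor
`sgn (a - b)`. -/
def doubledForm (f : ℝ × Space d → ℝ → Space d) (g : ℝ × Space d → ℝ → Space d →L[ℝ] Space d)
    (F : ℝ × Space d → ℝ → ℝ) (ψ κ : ℝ × Space d → ℝ)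
    (S : (ℝ × Space d) ≃L[ℝ] (ℝ × Space d)) (z : (ℝ × Space d) × (ℝ × Space d)) (a b : ℝ) : ℝ :=
  (a - b) * fderiv ℝ ψ z.1 (1, 0) * κ z.2
    + fderiv ℝ ψ z.1 (0, f z.1 a - f z.1 b) * κ z.2
    + ψ z.1 * fderiv ℝ κ z.2 (S.symm (0, (f z.1 a - f (z.1 - S z.2) a)
        - (f z.1 b - f (z.1 - S z.2) b)))
    + (F z.1 a - F (z.1 - S z.2) b - diagSum (g z.1 b) + diagSum (g (z.1 - S z.2) a))
        * (ψ z.1 * κ z.2)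

/-- The two inequalities carry opposite signs and opposite derivatives of `κ`, so the time
derivatives of `κ` cancel and the flux terms regroup into increments in `p` at fixed values `a` and
`b`. -/
theorem sign_mul_kruzkovForm_add (S : (ℝ × Space d) ≃L[ℝ] (ℝ × Space d))
    (z : (ℝ × Space d) × (ℝ × Space d)) (a b : ℝ) :
    Real.sign (a - b) * kruzkovForm f g F z.1 a b (ψ z.1 * κ z.2)
        (ψ z.1 • (fderiv ℝ κ z.2).comp (S.symm : (ℝ × Space d) →L[ℝ] (ℝ × Space d))
          + κ z.2 • fderiv ℝ ψ z.1)
      + Real.sign (b - a) * kruzkovForm f g F (z.1 - S z.2) b a (ψ z.1 * κ z.2)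
        (ψ z.1 • -(fderiv ℝ κ z.2).comp (S.symm : (ℝ × Space d) →L[ℝ] (ℝ × Space d)))
    = Real.sign (a - b) * doubledForm f g F ψ κ S z a b := by
  rw [← neg_sub a b, Real.sign_neg]
  set q := z.1 - S z.2 with hq
  have e : ((0 : ℝ), (f z.1 a - f q a) - (f z.1 b - f q b)) =
      (0, f z.1 a - f z.1 b) + ((0, f q b - f q a) : ℝ × Space d) := by
    ext1
    · simp
    · simp only [Prod.snd_add]; abel
  simp only [kruzkovForm, doubledForm, ← hq, e, map_add]
  simp only [add_apply, smul_apply, neg_apply,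
    ContinuousLinearMap.comp_apply, smul_eq_mul, ContinuousLinearEquiv.coe_coe]
  ring

theorem ContinuousFlux.integrable_doubled (hc : ContinuousFlux f g F)
    (hu : Measurable u) (hv : Measurable v) (huC : ∀ p, |u p| ≤ C) (hvC : ∀ p, |v p| ≤ C)
    (hψ : ContDiff ℝ ∞ ψ) (hψc : HasCompactSupport ψ) (hκ : ContDiff ℝ ∞ κ)
    (hκc : HasCompactSupport κ) (S : (ℝ × Space d) ≃L[ℝ] (ℝ × Space d)) :
    Integrable fun z : (ℝ × Space d) × (ℝ × Space d) =>
      Real.sign (u z.1 - v (z.1 - S z.2)) *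
        doubledForm f g F ψ κ S z (u z.1) (v (z.1 - S z.2)) := by
  have hψ' : Continuous (fderiv ℝ ψ) := hψ.continuous_fderiv (by simp)
  have hκ' : Continuous (fderiv ℝ κ) := hκ.continuous_fderiv (by simp)
  have hψ0 := hψ.continuous
  have hκ0 := hκ.continuous
  refine integrable_sign_mul volume (G := doubledForm f g F ψ κ S) ?_
    (K := tsupport ψ ×ˢ tsupport κ) (hψc.prod hκc) ?_ (hu.comp measurable_fst)
    (hv.comp (by fun_prop)) (fun _ => huC _) (fun _ => hvC _)
  · have hf : ∀ {p : ((ℝ × Space d) × (ℝ × Space d)) × ℝ × ℝ → ℝ × Space d}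
        {a : ((ℝ × Space d) × (ℝ × Space d)) × ℝ × ℝ → ℝ}, Continuous p → Continuous a →
        Continuous (fun x => f (p x) (a x)) ∧ Continuous (fun x => g (p x) (a x)) ∧
        Continuous (fun x => F (p x) (a x)) := fun hp ha =>
      ⟨hc.cont_f.comp (hp.prodMk ha), hc.cont_g.comp (hp.prodMk ha), hc.cont_F.comp (hp.prodMk ha)⟩
    have hq : Continuous fun x : ((ℝ × Space d) × (ℝ × Space d)) × ℝ × ℝ => x.1.1 - S x.1.2 := by
      fun_prop
    have hpp : Continuous fun x : ((ℝ × Space d) × (ℝ × Space d)) × ℝ × ℝ => x.1.1 := by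
      fun_prop
    have hζ : Continuous fun x : ((ℝ × Space d) × (ℝ × Space d)) × ℝ × ℝ => x.1.2 := by
      fun_prop
    have ha : Continuous fun x : ((ℝ × Space d) × (ℝ × Space d)) × ℝ × ℝ => x.2.1 := by
      fun_prop
    have hb : Continuous fun x : ((ℝ × Space d) × (ℝ × Space d)) × ℝ × ℝ => x.2.2 := by
      fun_prop
    obtain ⟨h1, -, h2⟩ := hf hpp ha
    obtain ⟨h3, h4, -⟩ := hf hpp hb
    obtain ⟨h5, h6, -⟩ := hf hq ha
    obtain ⟨h7, -, h8⟩ := hf hq hb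
    have h9 : Continuous fun x : ((ℝ × Space d) × (ℝ × Space d)) × ℝ × ℝ =>
        fderiv ℝ ψ x.1.1 (1, 0) := (hψ'.comp hpp).clm_apply continuous_const
    have h10 : Continuous fun x : ((ℝ × Space d) × (ℝ × Space d)) × ℝ × ℝ =>
        fderiv ℝ ψ x.1.1 (0, f x.1.1 x.2.1 - f x.1.1 x.2.2) :=
      (hψ'.comp hpp).clm_apply (continuous_const.prodMk (h1.sub h3))
    have h11 : Continuous fun x : ((ℝ × Space d) × (ℝ × Space d)) × ℝ × ℝ =>
        fderiv ℝ κ x.1.2 (S.symm (0, (f x.1.1 x.2.1 - f (x.1.1 - S x.1.2) x.2.1)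
          - (f x.1.1 x.2.2 - f (x.1.1 - S x.1.2) x.2.2))) :=
      (hκ'.comp hζ).clm_apply (S.symm.continuous.comp
        (continuous_const.prodMk ((h1.sub h5).sub (h3.sub h7))))
    exact (((((ha.sub hb).mul h9).mul (hκ0.comp hζ)).add (h10.mul (hκ0.comp hζ))).add
      ((hψ0.comp hpp).mul h11)).add ((((h2.sub h8).sub (continuous_diagSum.comp h4)).add
        (continuous_diagSum.comp h6)).mul ((hψ0.comp hpp).mul (hκ0.comp hζ)))
  · rintro ⟨p, ζ⟩ hz a b
    rw [mem_prod, not_and_or] at hz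
    rcases hz with hz | hz
    · have e1 := image_eq_zero_of_notMem_tsupport hz
      have e2 := image_eq_zero_of_notMem_tsupport (f := fderiv ℝ ψ)
        fun h => hz (tsupport_fderiv_subset ℝ h)
      simp only at e1 e2
      simp [doubledForm, e1, e2]
    · have e1 := image_eq_zero_of_notMem_tsupport hz
      have e2 := image_eq_zero_of_notMem_tsupport (f := fderiv ℝ κ)
        fun h => hz (tsupport_fderiv_subset ℝ h)
      simp only at e1 e2
      simp [doubledForm, e1, e2]

/-- Kružkov's doubling of variables. -/
theorem ContinuousFlux.integral_doubled_nonneg (hc : ContinuousFlux f g F)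
    (hu : Measurable u) (hv : Measurable v) (huC : ∀ p, |u p| ≤ C) (hvC : ∀ p, |v p| ≤ C)
    (hue : IsEntropic T f g F u) (hve : IsEntropic T f g F v) (hψ : IsTestFunction T ψ)
    (hκ : ContDiff ℝ ∞ κ) (hκc : HasCompactSupport κ) (hκ0 : ∀ ζ, 0 ≤ κ ζ)
    (S : (ℝ × Space d) ≃L[ℝ] (ℝ × Space d))
    (hS : ∀ p ∈ tsupport ψ, ∀ ζ ∈ tsupport κ, (p - S ζ).1 ∈ Ioo (0 : ℝ) T) :
    0 ≤ ∫ z : (ℝ × Space d) × (ℝ × Space d),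
      Real.sign (u z.1 - v (z.1 - S z.2)) *
        doubledForm f g F ψ κ S z (u z.1) (v (z.1 - S z.2)) := by
  have hψ0 := hψ.contDiff.continuous
  have hκ1 := hκ.continuous
  have hψ' : Continuous (fderiv ℝ ψ) := hψ.contDiff.continuous_fderiv (by simp)
  have hκ' : Continuous (fderiv ℝ κ) := hκ.continuous_fderiv (by simp)
  set N : (ℝ × Space d) →L[ℝ] (ℝ × Space d) :=
    (S.symm : (ℝ × Space d) →L[ℝ] (ℝ × Space d)) with hN
  have hd1 : ∀ p q, fderiv ℝ (fun p => ψ p * κ (N (p - q))) p =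
      ψ p • (fderiv ℝ κ (N (p - q))).comp N + κ (N (p - q)) • fderiv ℝ ψ p := fun p q => by
    have h1 : HasFDerivAt (fun p => N (p - q)) N p := by
      exact N.hasFDerivAt.comp p ((hasFDerivAt_id p).sub_const q)
    exact (((hψ.contDiff.differentiable (by simp)) p).hasFDerivAt.mul
      (((hκ.differentiable (by simp)) _).hasFDerivAt.comp p h1)).fderiv
  have hd2 : ∀ p q, fderiv ℝ (fun q => ψ p * κ (N (p - q))) q =
      ψ p • -(fderiv ℝ κ (N (p - q))).comp N := fun p q => by
    have h1 : HasFDerivAt (fun q => N (p - q)) (-N) q := by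
      have := N.hasFDerivAt.comp q ((hasFDerivAt_id q).const_sub p)
      rw [ContinuousLinearMap.comp_neg] at this
      exact this
    have := ((((hκ.differentiable (by simp)) _).hasFDerivAt.comp q h1).const_mul (ψ p)).fderiv
    rw [ContinuousLinearMap.comp_neg] at this
    exact this
  have ht1 : ∀ q, IsTestFunction T (fun p => ψ p * κ (N (p - q))) := fun q =>
    ⟨hψ.contDiff.mul (hκ.comp (by fun_prop)), hψ.hasCompactSupport.mul_right,
      (tsupport_mul_subset_left).trans hψ.tsupport_subset,
      fun p => mul_nonneg (hψ.nonneg p) (hκ0 _)⟩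
  -- In `p` the support is inherited from `ψ`; in `q` it lies in the image of `tsupport κ` under `ζ
  -- ↦ p - S ζ`, and `hS` keeps that image within `(0,T)`.
  have ht2 : ∀ p, IsTestFunction T (fun q => ψ p * κ (N (p - q))) := fun p => by
    set H : (ℝ × Space d) → (ℝ × Space d) := fun ζ => p - S ζ with hH
    have hsub : tsupport (fun q => ψ p * κ (N (p - q))) ⊆ H '' tsupport κ := by
      refine closure_minimal ?_ (hκc.isCompact.image (by fun_prop)).isClosed
      intro q hq
      refine ⟨N (p - q), subset_tsupport _ fun h => hq (by simp only [h, mul_zero]), by simp [hH, hN]⟩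
    refine ⟨contDiff_const.mul (hκ.comp (by fun_prop)), ?_, ?_,
      fun q => mul_nonneg (hψ.nonneg p) (hκ0 _)⟩
    · exact (hκc.isCompact.image (by fun_prop : Continuous H)).of_isClosed_subset
        (isClosed_tsupport _) hsub
    · by_cases hp : p ∈ tsupport ψ
      · intro q hq
        obtain ⟨ζ, hζ, rfl⟩ := hsub hq
        exact ⟨hS p hp ζ hζ, trivial⟩
      · simp [image_eq_zero_of_notMem_tsupport hp, tsupport]
  set K : Set ((ℝ × Space d) × (ℝ × Space d)) := shear S '' (tsupport ψ ×ˢ tsupport κ) with hKdef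
  have hK : IsCompact K :=
    (hψ.hasCompactSupport.isCompact.prod hκc.isCompact).image (shear S).continuous
  have hoff : ∀ x : (ℝ × Space d) × (ℝ × Space d), x ∉ K →
      ψ x.1 * κ (N (x.1 - x.2)) = 0 ∧ ψ x.1 • -(fderiv ℝ κ (N (x.1 - x.2))).comp N = 0 ∧
      ψ x.1 • (fderiv ℝ κ (N (x.1 - x.2))).comp N + κ (N (x.1 - x.2)) • fderiv ℝ ψ x.1 = 0 := by
    intro x hx
    have : ¬ (x.1 ∈ tsupport ψ ∧ N (x.1 - x.2) ∈ tsupport κ) := fun h =>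
      hx ⟨(x.1, N (x.1 - x.2)), h, by simp [shear_apply, hN]⟩
    rcases not_and_or.1 this with hz | hz
    · have e1 := image_eq_zero_of_notMem_tsupport hz
      have e2 := image_eq_zero_of_notMem_tsupport (f := fderiv ℝ ψ)
        fun h => hz (tsupport_fderiv_subset ℝ h)
      simp only [e1, e2]; simp
    · have e1 := image_eq_zero_of_notMem_tsupport hz
      have e2 := image_eq_zero_of_notMem_tsupport (f := fderiv ℝ κ)
        fun h => hz (tsupport_fderiv_subset ℝ h)
      simp only [e1, e2]; simp
  have hA := integrable_sign_mul (volume : Measure ((ℝ × Space d) × (ℝ × Space d)))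
    (G := fun x a b => kruzkovForm f g F x.1 a b (ψ x.1 * κ (N (x.1 - x.2)))
      (ψ x.1 • (fderiv ℝ κ (N (x.1 - x.2))).comp N + κ (N (x.1 - x.2)) • fderiv ℝ ψ x.1))
    (hc.continuous_kruzkovForm (by fun_prop) (by fun_prop) (by fun_prop) (by fun_prop)
      (by fun_prop)) hK
    (fun x hx a b => by rw [(hoff x hx).1, (hoff x hx).2.2]; simp [kruzkovForm])
    (U := fun x => u x.1) (V := fun x => v x.2)
    (hu.comp measurable_fst) (hv.comp measurable_snd) (fun _ => huC _) (fun _ => hvC _)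
  have hB := integrable_sign_mul (volume : Measure ((ℝ × Space d) × (ℝ × Space d)))
    (G := fun x a b => kruzkovForm f g F x.2 a b (ψ x.1 * κ (N (x.1 - x.2)))
      (ψ x.1 • -(fderiv ℝ κ (N (x.1 - x.2))).comp N))
    (hc.continuous_kruzkovForm (by fun_prop) (by fun_prop) (by fun_prop) (by fun_prop)
      (by fun_prop)) hK
    (fun x hx a b => by rw [(hoff x hx).1, (hoff x hx).2.1]; simp [kruzkovForm])
    (U := fun x => v x.2) (V := fun x => u x.1)
    (hv.comp measurable_snd) (hu.comp measurable_fst) (fun _ => hvC _) (fun _ => huC _)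
  have hA0 : 0 ≤ ∫ x : (ℝ × Space d) × (ℝ × Space d), Real.sign (u x.1 - v x.2) *
      kruzkovForm f g F x.1 (u x.1) (v x.2) (ψ x.1 * κ (N (x.1 - x.2)))
      (ψ x.1 • (fderiv ℝ κ (N (x.1 - x.2))).comp N + κ (N (x.1 - x.2)) • fderiv ℝ ψ x.1) := by
    -- Freezing `q` makes `v q` an admissible constant `k` in the inequality for `u`; below, the
    -- roles are exchanged.
    rw [Measure.volume_eq_prod, integral_prod_symm _ hA]
    refine integral_nonneg fun q => ?_
    have := hue (v q) _ (ht1 q)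
    simp_rw [hd1] at this
    exact this
  have hB0 : 0 ≤ ∫ x : (ℝ × Space d) × (ℝ × Space d), Real.sign (v x.2 - u x.1) *
      kruzkovForm f g F x.2 (v x.2) (u x.1) (ψ x.1 * κ (N (x.1 - x.2)))
      (ψ x.1 • -(fderiv ℝ κ (N (x.1 - x.2))).comp N) := by
    rw [Measure.volume_eq_prod, integral_prod _ hB]
    refine integral_nonneg fun p => ?_
    have := hve (u p) _ (ht2 p)
    simp_rw [hd2] at this
    exact this
  have hAB := add_nonneg hA0 hB0
  rw [← integral_add hA hB] at hAB
  -- Passing to the rescaled difference `ζ` fixes the kernel, so that all the dependence on the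
  -- scale sits in `q = p - S ζ`.
  have := integral_comp_continuousLinearEquiv_nonneg volume (shear S) hAB
  refine this.trans_eq (integral_congr_ae (Eventually.of_forall fun z => ?_))
  have hz : N (z.1 - (z.1 - S z.2)) = z.2 := by simp [hN]
  simp only [shear_apply, hz]
  exact sign_mul_kruzkovForm_add S z (u z.1) (v (z.1 - S z.2))

end Doubling

end

/-! ### Anisotropic scaling and the limit of the doubled inequality. -/

section

variable {d : ℕ}

/-- The anisotropic scaling `(σ, z) ↦ (τ σ, h z)` of `ℝ × ℝᵈ`. -/
def scaling {τ h : ℝ} (hτ : 0 < τ) (hh : 0 < h) : (ℝ × Space d) ≃L[ℝ] (ℝ × Space d) :=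
  (ContinuousLinearEquiv.smulLeft (Units.mk0 τ hτ.ne')).prodCongr
    (ContinuousLinearEquiv.smulLeft (Units.mk0 h hh.ne'))

theorem scaling_apply {τ h : ℝ} (hτ : 0 < τ) (hh : 0 < h) (ζ : ℝ × Space d) :
    scaling hτ hh ζ = (τ * ζ.1, h • ζ.2) := rfl

theorem scaling_symm_apply {τ h : ℝ} (hτ : 0 < τ) (hh : 0 < h) (v : Space d) :
    (scaling hτ hh).symm (0, v) = (0, h⁻¹ • v) := by
  rw [ContinuousLinearEquiv.symm_apply_eq, scaling_apply]
  simp [smul_smul, hh.ne']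

/-- The doubled integrand at `p`, `q` and the rescaled difference `ζ`, with `w` in place of the
difference quotient of the flux. -/
def splitForm (f : ℝ × Space d → ℝ → Space d) (g : ℝ × Space d → ℝ → Space d →L[ℝ] Space d)
    (F : ℝ × Space d → ℝ → ℝ) (ψ κ : ℝ × Space d → ℝ) (p q ζ : ℝ × Space d) (a b : ℝ)
    (w : Space d) : ℝ :=
  ((a - b) * fderiv ℝ ψ p (1, 0) + fderiv ℝ ψ p (0, f p a - f p b)
      + (F p a - F q b - diagSum (g p b) + diagSum (g q a)) * ψ p) * κ ζ
    + ψ p * fderiv ℝ κ ζ (0, w)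

section Limit

variable {f : ℝ × Space d → ℝ → Space d} {g : ℝ × Space d → ℝ → Space d →L[ℝ] Space d}
  {F : ℝ × Space d → ℝ → ℝ} {T C : ℝ} {u v : ℝ × Space d → ℝ} {ψ κ : ℝ × Space d → ℝ}

theorem doubledForm_scaling {τ h : ℝ} (hτ : 0 < τ) (hh : 0 < h)
    (z : (ℝ × Space d) × (ℝ × Space d)) (a b : ℝ) :
    doubledForm f g F ψ κ (scaling hτ hh) z a b =
      splitForm f g F ψ κ z.1 (z.1 - scaling hτ hh z.2) z.2 a b
        (h⁻¹ • (f z.1 a - f (z.1 - scaling hτ hh z.2) a)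
          - h⁻¹ • (f z.1 b - f (z.1 - scaling hτ hh z.2) b)) := by
  rw [doubledForm, splitForm, scaling_symm_apply, smul_sub h⁻¹ (_ - _)]
  ring

theorem ContinuousFlux.continuous_splitForm (hc : ContinuousFlux f g F)
    (hψ : ContDiff ℝ ∞ ψ) (hκ : ContDiff ℝ ∞ κ) {X : Type*} [TopologicalSpace X]
    {p q ζ : X → ℝ × Space d} {a b : X → ℝ} {w : X → Space d} (hp : Continuous p)
    (hq : Continuous q) (hζ : Continuous ζ) (ha : Continuous a) (hb : Continuous b)
    (hw : Continuous w) :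
    Continuous fun x => splitForm f g F ψ κ (p x) (q x) (ζ x) (a x) (b x) (w x) := by
  have hψ' : Continuous (fderiv ℝ ψ) := hψ.continuous_fderiv (by simp)
  have hκ' : Continuous (fderiv ℝ κ) := hκ.continuous_fderiv (by simp)
  have h1 : Continuous fun x => f (p x) (a x) := hc.cont_f.comp (hp.prodMk ha)
  have h2 : Continuous fun x => f (p x) (b x) := hc.cont_f.comp (hp.prodMk hb)
  have h3 : Continuous fun x => F (p x) (a x) := hc.cont_F.comp (hp.prodMk ha)
  have h4 : Continuous fun x => F (q x) (b x) := hc.cont_F.comp (hq.prodMk hb)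
  have h5 : Continuous fun x => g (p x) (b x) := hc.cont_g.comp (hp.prodMk hb)
  have h6 : Continuous fun x => g (q x) (a x) := hc.cont_g.comp (hq.prodMk ha)
  have h7 : Continuous fun x => fderiv ℝ ψ (p x) (1, 0) :=
    (hψ'.comp hp).clm_apply continuous_const
  have h8 : Continuous fun x => fderiv ℝ ψ (p x) (0, f (p x) (a x) - f (p x) (b x)) :=
    (hψ'.comp hp).clm_apply (continuous_const.prodMk (h1.sub h2))
  have h9 : Continuous fun x => fderiv ℝ κ (ζ x) (0, w x) :=
    (hκ'.comp hζ).clm_apply (continuous_const.prodMk hw)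
  exact (((((ha.sub hb).mul h7).add h8).add ((((h3.sub h4).sub (continuous_diagSum.comp h5)).add
    (continuous_diagSum.comp h6)).mul (hψ.continuous.comp hp))).mul (hκ.continuous.comp hζ)).add
    ((hψ.continuous.comp hp).mul h9)

theorem splitForm_eq_zero {p q ζ : ℝ × Space d} {a b : ℝ} {w : Space d}
    (h : ¬ (p ∈ tsupport ψ ∧ ζ ∈ tsupport κ)) : splitForm f g F ψ κ p q ζ a b w = 0 := by
  rcases not_and_or.1 h with hz | hz
  · have e1 := image_eq_zero_of_notMem_tsupport hz
    have e2 := image_eq_zero_of_notMem_tsupport (f := fderiv ℝ ψ)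
      fun h => hz (tsupport_fderiv_subset ℝ h)
    simp [splitForm, e1, e2]
  · have e1 := image_eq_zero_of_notMem_tsupport hz
    have e2 := image_eq_zero_of_notMem_tsupport (f := fderiv ℝ κ)
      fun h => hz (tsupport_fderiv_subset ℝ h)
    simp [splitForm, e1, e2]

/-- Sequences of scales along which the time oscillation of `f` near the compact set `K` is
negligible compared with the spatial scale. -/
structure ScalingSequence (T C r : ℝ) (f : ℝ × Space d → ℝ → Space d) (K : Set (ℝ × Space d))
    (h τ : ℕ → ℝ) : Prop where
  one_le : 1 ≤ r
  h_pos : ∀ n, 0 < h n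
  h_le_one : ∀ n, h n ≤ 1
  h_tendsto : Tendsto h atTop (𝓝 0)
  τ_pos : ∀ n, 0 < τ n
  τ_tendsto : Tendsto τ atTop (𝓝 0)
  norm_le : ∀ p ∈ K, |p.1| ≤ r ∧ ‖p.2‖ ≤ r
  norm_shift_le : ∀ n, ∀ p ∈ K, ∀ ζ ∈ Metric.closedBall (0 : ℝ × Space d) 1,
    |p.1 - τ n * ζ.1| ≤ r ∧ ‖p.2 - h n • ζ.2‖ ≤ r
  mem_Ioo : ∀ n, ∀ p ∈ K, ∀ ζ ∈ Metric.closedBall (0 : ℝ × Space d) 1,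
    p.1 - τ n * ζ.1 ∈ Ioo (0 : ℝ) T
  modulus : ∀ n, ∀ p ∈ K, ∀ ζ ∈ Metric.closedBall (0 : ℝ × Space d) 1, ∀ c, |c| ≤ C →
    ‖f (p.1, p.2 - h n • ζ.2) c - f (p.1 - τ n * ζ.1, p.2 - h n • ζ.2) c‖ ≤ h n ^ 2

/-- The space scale is `1 / (n + 1)`; the time scale is chosen afterwards, small enough for the
modulus of continuity of `f` at level `h n ^ 2`. -/
theorem ContinuousFlux.exists_scalingSequence (hc : ContinuousFlux f g F) (C : ℝ)
    {K : Set (ℝ × Space d)} (hK : IsCompact K) (hKT : K ⊆ Ioo (0 : ℝ) T ×ˢ univ) :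
    ∃ r h τ, ScalingSequence T C r f K h τ := by
  obtain ⟨m, hm, hmK⟩ := hK.exists_cthickening_subset_open (isOpen_Ioo.prod isOpen_univ) hKT
  obtain ⟨r₀, hr₀⟩ := hK.isBounded.subset_closedBall 0
  have hnorm : ∀ p ∈ K, |p.1| ≤ r₀ ∧ ‖p.2‖ ≤ r₀ := fun p hp => by
    have h := mem_closedBall_zero_iff.1 (hr₀ hp)
    exact ⟨(norm_fst_le p).trans h, (norm_snd_le p).trans h⟩
  have hnormζ : ∀ ζ ∈ Metric.closedBall (0 : ℝ × Space d) 1, |ζ.1| ≤ 1 ∧ ‖ζ.2‖ ≤ 1 :=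
    fun ζ hζ => by
      have h := mem_closedBall_zero_iff.1 hζ
      exact ⟨(norm_fst_le ζ).trans h, (norm_snd_le ζ).trans h⟩
  set r := max (r₀ + 1) 1 with hr
  set h : ℕ → ℝ := fun n => 1 / ((n : ℝ) + 1) with hhdef
  have hh : ∀ n, 0 < h n := fun n => Nat.one_div_pos_of_nat
  have hh1 : ∀ n, h n ≤ 1 := fun n => by
    rw [hhdef]
    exact (div_le_one (by positivity)).2 (by linarith [(Nat.cast_nonneg n : (0 : ℝ) ≤ n)])
  have hh0 : Tendsto h atTop (𝓝 0) := tendsto_one_div_add_atTop_nhds_zero_nat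
  choose τ' hτ' hmod' using fun n => hc.exists_time_modulus r C (pow_pos (hh n) 2)
  -- `τ' n` controls the time oscillation of `f`, `m` keeps shifted times inside `(0,T)`, and `h n`
  -- forces `τ n` to tend to zero.
  set τ : ℕ → ℝ := fun n => min (τ' n) (min m (h n)) with hτdef
  have hτ : ∀ n, 0 < τ n := fun n => lt_min (hτ' n) (lt_min hm (hh n))
  have hτm : ∀ n, τ n ≤ m := fun n => (min_le_right _ _).trans (min_le_left _ _)
  have hτh : ∀ n, τ n ≤ h n := fun n => (min_le_right _ _).trans (min_le_right _ _)
  have hτσ : ∀ n, ∀ ζ ∈ Metric.closedBall (0 : ℝ × Space d) 1, |τ n * ζ.1| ≤ τ n :=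
    fun n ζ hζ => by
      rw [abs_mul, abs_of_pos (hτ n)]
      exact mul_le_of_le_one_right (hτ n).le (hnormζ ζ hζ).1
  have hqt : ∀ n, ∀ p ∈ K, ∀ ζ ∈ Metric.closedBall (0 : ℝ × Space d) 1,
      |p.1 - τ n * ζ.1| ≤ r ∧ ‖p.2 - h n • ζ.2‖ ≤ r := by
    intro n p hp ζ hζ
    constructor
    · calc _ ≤ |p.1| + |τ n * ζ.1| := abs_sub _ _
        _ ≤ r₀ + 1 := add_le_add (hnorm p hp).1 ((hτσ n ζ hζ).trans ((hτh n).trans (hh1 n)))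
        _ ≤ r := le_max_left _ _
    · calc _ ≤ ‖p.2‖ + ‖h n • ζ.2‖ := norm_sub_le _ _
        _ ≤ r₀ + 1 := by
          refine add_le_add (hnorm p hp).2 ?_
          rw [norm_smul, Real.norm_of_nonneg (hh n).le]
          exact mul_le_one₀ (hh1 n) (norm_nonneg _) (hnormζ ζ hζ).2
        _ ≤ r := le_max_left _ _
  have hpr : ∀ p ∈ K, |p.1| ≤ r ∧ ‖p.2‖ ≤ r := fun p hp =>
    ⟨(hnorm p hp).1.trans ((by linarith : r₀ ≤ r₀ + 1).trans (le_max_left _ _)),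
      (hnorm p hp).2.trans ((by linarith : r₀ ≤ r₀ + 1).trans (le_max_left _ _))⟩
  refine ⟨r, h, τ, le_max_right _ _, hh, hh1, hh0, hτ, squeeze_zero (fun n => (hτ n).le) hτh hh0,
    hpr, hqt, ?_, ?_⟩
  · intro n p hp ζ hζ
    have : ((p.1 - τ n * ζ.1, p.2) : ℝ × Space d) ∈ Metric.cthickening m K := by
      refine Metric.mem_cthickening_of_dist_le _ p _ _ hp ?_
      rw [Prod.dist_eq, dist_self, max_eq_left dist_nonneg, Real.dist_eq]
      simpa using (hτσ n ζ hζ).trans (hτm n)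
    exact (hmK this).1
  · intro n p hp ζ hζ c hcC
    obtain ⟨h1, h2⟩ := hqt n p hp ζ hζ
    refine hmod' n _ _ _ c (hpr p hp).1 h1 h2 hcC ?_
    simpa using (hτσ n ζ hζ).trans (min_le_left _ _)

theorem ScalingSequence.tendsto_scaling {r : ℝ} {K : Set (ℝ × Space d)} {h τ : ℕ → ℝ}
    (hs : ScalingSequence T C r f K h τ) (ζ : ℝ × Space d) :
    Tendsto (fun n => scaling (hs.τ_pos n) (hs.h_pos n) ζ) atTop (𝓝 0) := by
  simp only [scaling_apply]
  have h1 := (hs.τ_tendsto.mul_const ζ.1).prodMk_nhds (hs.h_tendsto.smul_const ζ.2)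
  rw [zero_mul, zero_smul] at h1
  exact h1

/-- A dominating constant for the limit: the difference quotients stay in a fixed ball, so all
arguments of the continuous form `splitForm` range over one compact set. -/
theorem ContinuousFlux.exists_bound_splitForm (hc : ContinuousFlux f g F)
    (hψ : IsTestFunction T ψ) (hκ : ContDiff ℝ ∞ κ) {r : ℝ} {h τ : ℕ → ℝ}
    (hs : ScalingSequence T C r f (tsupport ψ) h τ) :
    ∃ M : ℝ, ∀ n, ∀ p ∈ tsupport ψ, ∀ ζ ∈ Metric.closedBall (0 : ℝ × Space d) 1, ∀ a b : ℝ,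
      |a| ≤ C → |b| ≤ C → ‖doubledForm f g F ψ κ (scaling (hs.τ_pos n) (hs.h_pos n)) (p, ζ) a b‖
        ≤ M := by
  obtain ⟨M, hM⟩ := ((isCompact_closedBall (0 : ℝ × Space d) r).prod
    (isCompact_Icc (a := -C) (b := C))).bddAbove_image hc.cont_g.norm.continuousOn
  have hgM : ∀ t y c, |t| ≤ r → ‖y‖ ≤ r → |c| ≤ C → ‖g (t, y) c‖ ≤ M := by
    intro t y c ht hy hcC
    refine hM ⟨((t, y), c), ⟨?_, abs_le.1 hcC⟩, rfl⟩
    rw [mem_closedBall_zero_iff]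
    exact max_le ht hy
  have hquot : ∀ n, ∀ p ∈ tsupport ψ, ∀ ζ ∈ Metric.closedBall (0 : ℝ × Space d) 1, ∀ c, |c| ≤ C →
      ‖(h n)⁻¹ • (f p c - f (p - scaling (hs.τ_pos n) (hs.h_pos n) ζ) c)‖ ≤ |M| + 1 := by
    intro n p hp ζ hζ c hcC
    have hpr := hs.norm_le p hp
    have := hc.norm_quotient_le (p := p) (z := ζ.2) (c := c) (h := h n) (s := p.1 - τ n * ζ.1)
      (M := |M|) (r := r) (hs.h_pos n)
      (fun y hy => (hgM _ _ _ hpr.1 (mem_closedBall_zero_iff.1 hy) hcC).trans (le_abs_self M))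
      (mem_closedBall_zero_iff.2 hpr.2)
      (mem_closedBall_zero_iff.2 (hs.norm_shift_le n p hp ζ hζ).2) (hs.modulus n p hp ζ hζ c hcC)
    refine this.trans (add_le_add ?_ (hs.h_le_one n))
    exact mul_le_of_le_one_right (abs_nonneg M)
      ((norm_snd_le ζ).trans (mem_closedBall_zero_iff.1 hζ))
  have hcomp : IsCompact (tsupport ψ ×ˢ Metric.closedBall (0 : ℝ × Space d) r ×ˢ
      Metric.closedBall (0 : ℝ × Space d) 1 ×ˢ Icc (-C) C ×ˢ Icc (-C) C ×ˢ
      Metric.closedBall (0 : Space d) (2 * (|M| + 1))) :=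
    hψ.hasCompactSupport.isCompact.prod ((isCompact_closedBall _ r).prod
      ((isCompact_closedBall _ 1).prod (isCompact_Icc.prod
        (isCompact_Icc.prod (isCompact_closedBall _ _)))))
  obtain ⟨M₁, hM₁⟩ := hcomp.exists_bound_of_continuousOn
    (hc.continuous_splitForm hψ.contDiff hκ
      (X := (ℝ × Space d) × (ℝ × Space d) × (ℝ × Space d) × ℝ × ℝ × Space d)
      (p := fun x => x.1) (q := fun x => x.2.1) (ζ := fun x => x.2.2.1) (a := fun x => x.2.2.2.1)
      (b := fun x => x.2.2.2.2.1) (w := fun x => x.2.2.2.2.2) (by fun_prop) (by fun_prop)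
      (by fun_prop) (by fun_prop) (by fun_prop) (by fun_prop)).continuousOn
  refine ⟨M₁, fun n p hp ζ hζ a b ha hb => ?_⟩
  rw [doubledForm_scaling]
  refine hM₁ (p, p - scaling (hs.τ_pos n) (hs.h_pos n) ζ, ζ, a, b, _)
    ⟨hp, ?_, hζ, abs_le.1 ha, abs_le.1 hb, ?_⟩
  · rw [mem_closedBall_zero_iff]
    exact max_le (hs.norm_shift_le n p hp ζ hζ).1 (hs.norm_shift_le n p hp ζ hζ).2
  · rw [mem_closedBall_zero_iff, two_mul]
    exact (norm_sub_le _ _).trans (add_le_add (hquot n p hp ζ hζ _ ha) (hquot n p hp ζ hζ _ hb))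

theorem ContinuousFlux.tendsto_doubled (hc : ContinuousFlux f g F)
    (hψ : IsTestFunction T ψ) (hκ : ContDiff ℝ ∞ κ) {r : ℝ} {h τ : ℕ → ℝ}
    (hs : ScalingSequence T C r f (tsupport ψ) h τ) {φ : ℕ → ℕ} (hφ : Tendsto φ atTop atTop)
    {p ζ : ℝ × Space d} (hp : p ∈ tsupport ψ) (hζ : ζ ∈ Metric.closedBall (0 : ℝ × Space d) 1)
    {a b₀ : ℝ} {b : ℕ → ℝ} (ha : |a| ≤ C) (hb : ∀ n, |b n| ≤ C) (hbt : Tendsto b atTop (𝓝 b₀)) :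
    Tendsto (fun n => Real.sign (a - b n) *
        doubledForm f g F ψ κ (scaling (hs.τ_pos (φ n)) (hs.h_pos (φ n))) (p, ζ) a (b n)) atTop
      (𝓝 (Real.sign (a - b₀) *
        splitForm f g F ψ κ p p ζ a b₀ ((g p a - g p b₀) ζ.2))) := by
  simp only [doubledForm_scaling]
  refine tendsto_sign_mul (tendsto_const_nhds.sub hbt) ?_ ?_
  · have hq : Tendsto (fun n => p - scaling (hs.τ_pos (φ n)) (hs.h_pos (φ n)) ζ) atTop (𝓝 p) := by
      have := (tendsto_const_nhds (x := p)).sub ((hs.tendsto_scaling ζ).comp hφ)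
      rw [sub_zero] at this
      exact this
    have hquo : ∀ {c : ℕ → ℝ} {c₀ : ℝ}, (∀ n, |c n| ≤ C) → Tendsto c atTop (𝓝 c₀) →
        Tendsto (fun n => (h (φ n))⁻¹ •
          (f p (c n) - f (p - scaling (hs.τ_pos (φ n)) (hs.h_pos (φ n)) ζ) (c n))) atTop
          (𝓝 (g p c₀ ζ.2)) := fun {c c₀} hcC hcn =>
      hc.tendsto_quotient (s := fun n => p.1 - τ (φ n) * ζ.1) hcn (fun n => hs.h_pos (φ n))
        (hs.h_tendsto.comp hφ) (fun n => hs.modulus (φ n) p hp ζ hζ (c n) (hcC n))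
    have hw := (hquo (fun _ => ha) tendsto_const_nhds).sub (hquo hb hbt)
    rw [← sub_apply (g p a) (g p b₀)] at hw
    have hcont := (hc.continuous_splitForm hψ.contDiff hκ
      (X := (ℝ × Space d) × ℝ × Space d) (p := fun _ => p) (q := fun x => x.1)
      (ζ := fun _ => ζ) (a := fun _ => a) (b := fun x => x.2.1) (w := fun x => x.2.2)
      (by fun_prop) (by fun_prop) (by fun_prop) (by fun_prop) (by fun_prop) (by fun_prop))
    have hlim := (hcont.tendsto (p, b₀, (g p a - g p b₀) ζ.2)).comp
      (hq.prodMk_nhds (hbt.prodMk_nhds hw))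
    simp only [Function.comp_def] at hlim
    exact hlim
  -- Where `a = b₀` the limiting form vanishes, as both the flux differences and the source and
  -- divergence terms at `q = p` cancel.
  · intro hzero
    rw [sub_eq_zero] at hzero
    rw [← hzero]
    have e : ((0 : ℝ), (0 : Space d)) = 0 := rfl
    simp [splitForm, e]

/-- Passing to the limit in the doubled inequality, before integrating out the kernel. -/
theorem ContinuousFlux.integral_splitForm_nonneg (hc : ContinuousFlux f g F)
    (hu : Measurable u) (hv : Measurable v) (huC : ∀ p, |u p| ≤ C) (hvC : ∀ p, |v p| ≤ C)
    (hue : IsEntropic T f g F u) (hve : IsEntropic T f g F v) (hψ : IsTestFunction T ψ)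
    (hκ : ContDiff ℝ ∞ κ) (hκc : tsupport κ ⊆ Metric.closedBall 0 1) (hκ0 : ∀ ζ, 0 ≤ κ ζ) :
    0 ≤ ∫ z : (ℝ × Space d) × (ℝ × Space d), Real.sign (u z.1 - v z.1) *
      splitForm f g F ψ κ z.1 z.1 z.2 (u z.1) (v z.1)
        ((g z.1 (u z.1) - g z.1 (v z.1)) z.2.2) := by
  have hκs : HasCompactSupport κ := (isCompact_closedBall _ _).of_isClosed_subset
    (isClosed_tsupport _) hκc
  obtain ⟨r, h, τ, hs⟩ := hc.exists_scalingSequence C hψ.hasCompactSupport.isCompact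
    hψ.tsupport_subset
  set S : ℕ → (ℝ × Space d) ≃L[ℝ] (ℝ × Space d) :=
    fun n => scaling (hs.τ_pos n) (hs.h_pos n) with hSdef
  obtain ⟨φ, hφ, hae⟩ := exists_subseq_ae_tendsto_translate volume hv hvC
    (S := fun n => S n) (fun n => (S n).continuous.measurable) hs.tendsto_scaling r
  rw [Measure.prod_restrict, ← Measure.volume_eq_prod, ae_restrict_iff'
    (Metric.isClosed_closedBall.measurableSet.prod Metric.isClosed_closedBall.measurableSet)] at hae
  obtain ⟨M, hM⟩ := hc.exists_bound_splitForm hψ hκ hs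
  set D : ℕ → (ℝ × Space d) × (ℝ × Space d) → ℝ := fun n z =>
    Real.sign (u z.1 - v (z.1 - S n z.2)) *
      doubledForm f g F ψ κ (S n) z (u z.1) (v (z.1 - S n z.2)) with hD
  have hDint : ∀ n, Integrable (D n) := fun n =>
    hc.integrable_doubled hu hv huC hvC hψ.contDiff hψ.hasCompactSupport hκ hκs (S n)
  have hDnonneg : ∀ n, 0 ≤ ∫ z, D n z := fun n =>
    hc.integral_doubled_nonneg hu hv huC hvC hue hve hψ hκ hκs hκ0 (S n)
      fun p hp ζ hζ => hs.mem_Ioo n p hp ζ (hκc hζ)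
  set B := tsupport ψ ×ˢ Metric.closedBall (0 : ℝ × Space d) 1 with hB
  have hBc : IsCompact B := hψ.hasCompactSupport.isCompact.prod (isCompact_closedBall _ _)
  have hzero : ∀ n z, ¬ (z.1 ∈ tsupport ψ ∧ z.2 ∈ tsupport κ) → D n z = 0 := fun n z hz => by
    simp only [hD, hSdef, doubledForm_scaling, splitForm_eq_zero hz, mul_zero]
  have hbound : ∀ n z, ‖D n z‖ ≤ B.indicator (fun _ => M) z := by
    intro n z
    by_cases hz : z ∈ B
    · rw [indicator_of_mem hz, norm_mul]
      exact (mul_le_of_le_one_left (norm_nonneg _) (abs_sign_le_one _)).trans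
        (hM n z.1 hz.1 z.2 hz.2 _ _ (huC _) (hvC _))
    · rw [indicator_of_notMem hz, hzero n z fun h => hz ⟨h.1, hκc h.2⟩, norm_zero]
  refine ge_of_tendsto' (tendsto_integral_of_dominated_convergence (F := fun n => D (φ n))
    (B.indicator fun _ => M) (fun n => (hDint (φ n)).aestronglyMeasurable) ?_
    (fun n => Eventually.of_forall (hbound (φ n))) ?_) (fun n => hDnonneg (φ n))
  · rw [integrable_indicator_iff hBc.measurableSet]
    exact integrableOn_const hBc.measure_lt_top.ne
  filter_upwards [hae] with z hz
  by_cases hzs : z.1 ∈ tsupport ψ ∧ z.2 ∈ tsupport κ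
  · have hzr := hz ⟨mem_closedBall_zero_iff.2
      (max_le (hs.norm_le _ hzs.1).1 (hs.norm_le _ hzs.1).2),
      Metric.closedBall_subset_closedBall hs.one_le (hκc hzs.2)⟩
    exact hc.tendsto_doubled hψ hκ hs hφ.tendsto_atTop hzs.1 (hκc hzs.2) (huC _)
      (fun n => hvC _) hzr
  · simp only [hzero _ z hzs, splitForm_eq_zero hzs, mul_zero]
    exact tendsto_const_nhds

/-- Kružkov's inequality for the difference of two entropy solutions of the same equation. -/
theorem ContinuousFlux.integral_kato_nonneg (hc : ContinuousFlux f g F)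
    (hu : Measurable u) (hv : Measurable v) (huC : ∀ p, |u p| ≤ C) (hvC : ∀ p, |v p| ≤ C)
    (hue : IsEntropic T f g F u) (hve : IsEntropic T f g F v) (hψ : IsTestFunction T ψ) :
    0 ≤ ∫ p, Real.sign (u p - v p) * ((u p - v p) * fderiv ℝ ψ p (1, 0)
      + fderiv ℝ ψ p (0, f p (u p) - f p (v p)) + (F p (u p) - F p (v p)) * ψ p) := by
  let κ₀ : ContDiffBump (0 : ℝ × Space d) := ⟨1 / 2, 1, by norm_num, by norm_num⟩
  set κ := κ₀.normed volume with hκdef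
  have hκ : ContDiff ℝ ∞ κ := κ₀.contDiff_normed
  have hκc : tsupport κ = Metric.closedBall 0 1 := κ₀.tsupport_normed_eq
  have hκs : HasCompactSupport κ := κ₀.hasCompactSupport_normed
  have hκi : ∫ ζ, κ ζ = 1 := κ₀.integral_normed
  have hκ' : Continuous (fderiv ℝ κ) := hκ.continuous_fderiv (by simp)
  have key := hc.integral_splitForm_nonneg hu hv huC hvC hue hve hψ hκ hκc.subset
    (fun ζ => κ₀.nonneg_normed ζ)
  have hint := integrable_sign_mul (volume : Measure ((ℝ × Space d) × (ℝ × Space d)))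
    (G := fun z a b => splitForm f g F ψ κ z.1 z.1 z.2 a b ((g z.1 a - g z.1 b) z.2.2))
    (K := tsupport ψ ×ˢ tsupport κ) (hc.continuous_splitForm hψ.contDiff hκ (by fun_prop)
      (by fun_prop) (by fun_prop) (by fun_prop) (by fun_prop)
      (((hc.cont_g.comp (by fun_prop : Continuous fun z :
          ((ℝ × Space d) × (ℝ × Space d)) × ℝ × ℝ => (z.1.1, z.2.1))).sub
        (hc.cont_g.comp (by fun_prop : Continuous fun z :
          ((ℝ × Space d) × (ℝ × Space d)) × ℝ × ℝ => (z.1.1, z.2.2)))).clm_apply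
        (by fun_prop))) (hψ.hasCompactSupport.isCompact.prod hκs.isCompact)
    (fun z hz a b => splitForm_eq_zero hz) (U := fun z => u z.1) (V := fun z => v z.1)
    (hu.comp measurable_fst) (hv.comp measurable_fst) (fun _ => huC _) (fun _ => hvC _)
  -- Integrating over `ζ` first: the kernel has mass one, and the gradient term yields minus
  -- `diagSum (g p (u p) - g p (v p))`, which cancels the divergences.
  rw [Measure.volume_eq_prod, integral_prod _ hint] at key
  refine key.trans_eq (integral_congr_ae (Eventually.of_forall fun p => ?_))
  simp only [splitForm]
  rw [integral_const_mul, integral_add, integral_const_mul, integral_const_mul,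
    integral_fderiv_linear_field hκ hκs, hκi, diagSum_sub]
  · ring
  · exact (hκ.continuous.integrable_of_hasCompactSupport hκs).const_mul _
  · refine Integrable.const_mul (Continuous.integrable_of_hasCompactSupport ?_ ?_) _
    · exact hκ'.clm_apply (by fun_prop)
    · refine (hκs.fderiv ℝ).mono fun ζ hζ => ?_
      intro h0
      exact hζ (by simp [h0])

end Limit

end

/-! ### The cone weight and finite speed of propagation. -/

section

variable {d : ℕ}

theorem differentiable_smoothTransition : Differentiable ℝ Real.smoothTransition :=
  (Real.smoothTransition.contDiff (n := 1)).differentiable (by simp)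

theorem deriv_smoothTransition_nonneg (x : ℝ) : 0 ≤ deriv Real.smoothTransition x :=
  Real.smoothTransition.monotone.deriv_nonneg

theorem continuous_deriv_smoothTransition : Continuous (deriv Real.smoothTransition) :=
  (Real.smoothTransition.contDiff (n := 1)).continuous_deriv (by simp)

theorem deriv_smoothTransition_eq_zero {x : ℝ} (hx : x ∉ Icc (0 : ℝ) 1) :
    deriv Real.smoothTransition x = 0 := by
  rw [mem_Icc, not_and_or, not_le, not_le] at hx
  rcases hx with hx | hx
  · have : Real.smoothTransition =ᶠ[𝓝 x] fun _ => 0 := by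
      filter_upwards [Iio_mem_nhds hx] with y hy
      exact Real.smoothTransition.zero_of_nonpos (le_of_lt hy)
    rw [this.deriv_eq, deriv_const]
  · have : Real.smoothTransition =ᶠ[𝓝 x] fun _ => 1 := by
      filter_upwards [Ioi_mem_nhds hx] with y hy
      exact Real.smoothTransition.one_of_one_le (le_of_lt hy)
    rw [this.deriv_eq, deriv_const]

theorem exists_deriv_smoothTransition_le : ∃ B : ℝ, ∀ x, deriv Real.smoothTransition x ≤ B := by
  obtain ⟨B, hB⟩ := (isCompact_Icc (a := (0 : ℝ)) (b := 1)).exists_bound_of_continuousOn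
    continuous_deriv_smoothTransition.continuousOn
  refine ⟨max B 0, fun x => ?_⟩
  by_cases hx : x ∈ Icc (0 : ℝ) 1
  · exact (le_abs_self _).trans ((hB x hx).trans (le_max_left _ _))
  · rw [deriv_smoothTransition_eq_zero hx]
    exact le_max_right _ _

/-- The smoothed, exponentially weighted indicator function of the backward light cone
`√(1 + |x|²) + M t < R`, `t < T'`. -/
def coneWeight (L M R T' : ℝ) (p : ℝ × Space d) : ℝ :=
  Real.exp (-(L + 1) * p.1) * Real.smoothTransition (T' - p.1)
    * Real.smoothTransition (R - √(1 + ‖p.2‖ ^ 2) - M * p.1)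

/-- The cone weight, cut off near the initial time. -/
def coneTest (L M R T' δ : ℝ) (p : ℝ × Space d) : ℝ :=
  Real.smoothTransition (p.1 / δ - 1) * coneWeight L M R T' p

section Cone

variable {L M R T' δ T : ℝ}

theorem coneWeight_nonneg (p : ℝ × Space d) : 0 ≤ coneWeight L M R T' p :=
  mul_nonneg (mul_nonneg (Real.exp_pos _).le (Real.smoothTransition.nonneg _))
    (Real.smoothTransition.nonneg _)

theorem coneTest_nonneg (p : ℝ × Space d) : 0 ≤ coneTest L M R T' δ p :=
  mul_nonneg (Real.smoothTransition.nonneg _) (coneWeight_nonneg p)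

theorem coneWeight_le_one (hL : 0 ≤ L) {p : ℝ × Space d} (hp : 0 ≤ p.1) :
    coneWeight L M R T' p ≤ 1 := by
  refine mul_le_one₀ (mul_le_one₀ ?_ (Real.smoothTransition.nonneg _)
    (Real.smoothTransition.le_one _)) (Real.smoothTransition.nonneg _)
    (Real.smoothTransition.le_one _)
  rw [Real.exp_le_one_iff]
  nlinarith

theorem coneWeight_eq_zero {p : ℝ × Space d}
    (h : T' ≤ p.1 ∨ R ≤ √(1 + ‖p.2‖ ^ 2) + M * p.1) : coneWeight L M R T' p = 0 := by
  rcases h with h | h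
  · rw [coneWeight, Real.smoothTransition.zero_of_nonpos (x := T' - p.1) (by linarith)]
    simp
  · rw [coneWeight, Real.smoothTransition.zero_of_nonpos (x := R - _ - _) (by linarith)]
    simp

theorem coneWeight_pos {p : ℝ × Space d} (h : p.1 < T') (h' : √(1 + ‖p.2‖ ^ 2) + M * p.1 < R) :
    0 < coneWeight L M R T' p :=
  mul_pos (mul_pos (Real.exp_pos _) (Real.smoothTransition.pos_of_pos (by linarith)))
    (Real.smoothTransition.pos_of_pos (by linarith))

theorem coneWeight_eq_zero_of_norm (hM : 0 ≤ M) {p : ℝ × Space d} (hp : 0 ≤ p.1)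
    (hR : R ≤ ‖p.2‖) : coneWeight L M R T' p = 0 := by
  refine coneWeight_eq_zero (Or.inr ?_)
  have h1 : ‖p.2‖ ≤ √(1 + ‖p.2‖ ^ 2) := Real.le_sqrt_of_sq_le (by linarith)
  nlinarith [mul_nonneg hM hp]

theorem contDiff_coneWeight : ContDiff ℝ ∞ (coneWeight (d := d) L M R T') := by
  have hσ : ContDiff ℝ ∞ Real.smoothTransition := Real.smoothTransition.contDiff
  unfold coneWeight
  refine ContDiff.mul (ContDiff.mul ?_ (hσ.comp (by fun_prop))) (hσ.comp ?_)
  · exact Real.contDiff_exp.comp (by fun_prop)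
  · refine ContDiff.sub (contDiff_const.sub (ContDiff.sqrt ?_ fun p => by positivity)) (by fun_prop)
    exact contDiff_const.add (contDiff_snd.norm_sq ℝ)

theorem contDiff_coneTest : ContDiff ℝ ∞ (coneTest (d := d) L M R T' δ) := by
  have hσ : ContDiff ℝ ∞ Real.smoothTransition := Real.smoothTransition.contDiff
  unfold coneTest
  exact (hσ.comp (by fun_prop)).mul contDiff_coneWeight

theorem mul_coneWeight_eq_zero (hM : 0 ≤ M) (hδ : 0 < δ) {θ : ℝ → ℝ} (hθ : ∀ s < 0, θ s = 0)
    {p : ℝ × Space d} (hp : p ∉ Icc δ T' ×ˢ Metric.closedBall 0 R) :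
    θ (p.1 / δ - 1) * coneWeight L M R T' p = 0 := by
  by_cases h1 : p.1 < δ
  · rw [hθ, zero_mul]
    rw [sub_neg, div_lt_one hδ]
    exact h1
  · rw [not_lt] at h1
    rw [mem_prod, mem_Icc, mem_closedBall_zero_iff, not_and_or, not_and_or] at hp
    rcases hp with (hp | hp) | hp
    · exact absurd h1 hp
    · rw [coneWeight_eq_zero (Or.inl (not_le.1 hp).le), mul_zero]
    · rw [coneWeight_eq_zero_of_norm hM (hδ.le.trans h1) (not_le.1 hp).le, mul_zero]

theorem isTestFunction_coneTest (hM : 0 ≤ M) (hδ : 0 < δ) (hT : T' < T) :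
    IsTestFunction T (coneTest (d := d) L M R T' δ) := by
  have hK : IsCompact (Icc δ T' ×ˢ Metric.closedBall (0 : Space d) R) :=
    isCompact_Icc.prod (isCompact_closedBall _ _)
  have h0 : ∀ p, p ∉ Icc δ T' ×ˢ Metric.closedBall (0 : Space d) R →
      coneTest L M R T' δ p = 0 := fun p hp =>
    mul_coneWeight_eq_zero hM hδ (fun s hs => Real.smoothTransition.zero_of_nonpos hs.le) hp
  refine ⟨contDiff_coneTest, HasCompactSupport.intro hK h0, ?_, coneTest_nonneg⟩
  refine (closure_minimal (fun p hp => ?_) hK.isClosed).trans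
    (prod_mono (Icc_subset_Ioo hδ hT) (subset_univ _))
  by_contra h
  exact hp (h0 p h)

/-- The function `√(1 + |x|²)` is smooth with gradient of norm at most one, so the drift `-M t` in
the spatial cutoff dominates a flux `v` with `‖v‖ ≤ M * s`. The final time cutoff only helps, and
the exponential gives the rate `L + 1`. In use, `s` is `|u - v|` and `v` the flux difference. -/
theorem exists_hasFDerivAt_coneWeight (p : ℝ × Space d) :
    ∃ ℓ : ℝ × Space d →L[ℝ] ℝ, HasFDerivAt (coneWeight L M R T') ℓ p ∧
      ∀ (s : ℝ) (v : Space d), 0 ≤ s → ‖v‖ ≤ M * s →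
        s * ℓ (1, 0) + |ℓ (0, v)| ≤ -(L + 1) * (s * coneWeight L M R T' p) := by
  have hq0 : 0 < 1 + ‖p.2‖ ^ 2 := by positivity
  have hfst : HasFDerivAt (fun q : ℝ × Space d => q.1) (ContinuousLinearMap.fst ℝ ℝ (Space d)) p :=
    hasFDerivAt_fst
  have hsnd : HasFDerivAt (fun q : ℝ × Space d => q.2) (ContinuousLinearMap.snd ℝ ℝ (Space d)) p :=
    hasFDerivAt_snd
  have h1 : HasFDerivAt (fun q : ℝ × Space d => Real.exp (-(L + 1) * q.1)) _ p :=
    (hfst.const_mul (-(L + 1))).exp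
  have h2 : HasFDerivAt (fun q : ℝ × Space d => Real.smoothTransition (T' - q.1)) _ p :=
    (differentiable_smoothTransition _).hasDerivAt.comp_hasFDerivAt p (hfst.const_sub T')
  have h3 : HasFDerivAt (fun q : ℝ × Space d => √(1 + ‖q.2‖ ^ 2)) _ p :=
    ((hsnd.norm_sq).const_add 1).sqrt hq0.ne'
  have h4 : HasFDerivAt (fun q : ℝ × Space d =>
      Real.smoothTransition (R - √(1 + ‖q.2‖ ^ 2) - M * q.1)) _ p :=
    (differentiable_smoothTransition _).hasDerivAt.comp_hasFDerivAt p
      ((h3.const_sub R).sub (hfst.const_mul M))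
  have hE := (Real.exp_pos (-(L + 1) * p.1)).le
  have hS := Real.smoothTransition.nonneg (T' - p.1)
  have hη := Real.smoothTransition.nonneg (R - √(1 + ‖p.2‖ ^ 2) - M * p.1)
  have hS' := deriv_smoothTransition_nonneg (T' - p.1)
  have hη' := deriv_smoothTransition_nonneg (R - √(1 + ‖p.2‖ ^ 2) - M * p.1)
  have hsq : 0 < √(1 + ‖p.2‖ ^ 2) := Real.sqrt_pos.2 hq0
  have hle : ‖p.2‖ ≤ √(1 + ‖p.2‖ ^ 2) := Real.le_sqrt_of_sq_le (by linarith)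
  have hmul := (h1.mul h2).mul h4
  rw [Pi.mul_apply] at hmul
  have hW : coneWeight L M R T' p = Real.exp (-(L + 1) * p.1) * Real.smoothTransition (T' - p.1)
    * Real.smoothTransition (R - √(1 + ‖p.2‖ ^ 2) - M * p.1) := rfl
  rw [hW]
  generalize Real.exp (-(L + 1) * p.1) = E at *
  generalize Real.smoothTransition (T' - p.1) = σ₁ at *
  generalize Real.smoothTransition (R - √(1 + ‖p.2‖ ^ 2) - M * p.1) = σ₂ at *
  generalize deriv Real.smoothTransition (T' - p.1) = τ₁ at *
  generalize deriv Real.smoothTransition (R - √(1 + ‖p.2‖ ^ 2) - M * p.1) = τ₂ at *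
  refine ⟨(-(L + 1) * (E * σ₁ * σ₂) - E * τ₁ * σ₂ - E * σ₁ * τ₂ * M) •
      ContinuousLinearMap.fst ℝ ℝ (Space d) - (E * σ₁ * τ₂ * (√(1 + ‖p.2‖ ^ 2))⁻¹) •
      (innerSL ℝ p.2).comp (ContinuousLinearMap.snd ℝ ℝ (Space d)),
    hmul.congr_fderiv (ContinuousLinearMap.ext fun z => ?_), fun s v hs hv => ?_⟩
  · simp
    ring
  · have hQ : |(√(1 + ‖p.2‖ ^ 2))⁻¹ * inner ℝ p.2 v| ≤ M * s := by
      rw [abs_mul, abs_of_pos (inv_pos.2 hsq), inv_mul_le_iff₀ hsq]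
      exact (abs_real_inner_le_norm _ _).trans (mul_le_mul hle hv (norm_nonneg _) hsq.le)
    have e2 : |-(E * σ₁ * τ₂ * ((√(1 + ‖p.2‖ ^ 2))⁻¹ * inner ℝ p.2 v))| ≤
        E * σ₁ * τ₂ * (M * s) := by
      rw [abs_neg, abs_mul, abs_of_nonneg (by positivity)]
      exact mul_le_mul_of_nonneg_left hQ (by positivity)
    have e3 : 0 ≤ s * (E * τ₁ * σ₂) := by positivity
    have e4 : s * ((-(L + 1) * (E * σ₁ * σ₂) - E * τ₁ * σ₂ - E * σ₁ * τ₂ * M))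
        + |-(E * σ₁ * τ₂ * ((√(1 + ‖p.2‖ ^ 2))⁻¹ * inner ℝ p.2 v))| ≤
        -(L + 1) * (s * (E * σ₁ * σ₂)) := by linarith
    refine le_of_eq_of_le ?_ e4
    simp [mul_assoc]

variable {f : ℝ × Space d → ℝ → Space d} {g : ℝ × Space d → ℝ → Space d →L[ℝ] Space d}
  {F : ℝ × Space d → ℝ → ℝ} {C : ℝ} {u v : ℝ × Space d → ℝ}

theorem hasFDerivAt_coneTest (p : ℝ × Space d) {ℓ : ℝ × Space d →L[ℝ] ℝ}
    (hℓ : HasFDerivAt (coneWeight L M R T') ℓ p) :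
    HasFDerivAt (coneTest L M R T' δ) (Real.smoothTransition (p.1 / δ - 1) • ℓ +
      (deriv Real.smoothTransition (p.1 / δ - 1) / δ * coneWeight L M R T' p) •
        ContinuousLinearMap.fst ℝ ℝ (Space d)) p := by
  have hfst : HasFDerivAt (fun q : ℝ × Space d => q.1) (ContinuousLinearMap.fst ℝ ℝ (Space d)) p :=
    hasFDerivAt_fst
  have h1 : HasFDerivAt (fun q : ℝ × Space d => Real.smoothTransition (q.1 / δ - 1)) _ p :=
    (differentiable_smoothTransition _).hasDerivAt.comp_hasFDerivAt p
      ((hfst.mul_const δ⁻¹).sub_const 1)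
  refine (h1.mul hℓ).congr_fderiv (ContinuousLinearMap.ext fun z => ?_)
  simp [div_eq_mul_inv]
  ring

/-- Integrability of bounded functions against the functions appearing in the cone estimate. -/
theorem integrable_mul_coneWeight (hM : 0 ≤ M) (hδ : 0 < δ) {θ : ℝ → ℝ} (hθc : Continuous θ)
    (hθ : ∀ s < 0, θ s = 0) {w : ℝ × Space d → ℝ} (hw : Measurable w) (hwC : ∀ p, |w p| ≤ C) :
    Integrable fun p : ℝ × Space d => w p * (θ (p.1 / δ - 1) * coneWeight L M R T' p) := by
  have hW := (contDiff_coneWeight (d := d) (L := L) (M := M) (R := R) (T' := T')).continuous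
  refine Integrable.bdd_mul (c := C) ?_ hw.aestronglyMeasurable (Eventually.of_forall hwC)
  refine Continuous.integrable_of_hasCompactSupport (by fun_prop) ?_
  exact HasCompactSupport.intro (isCompact_Icc.prod (isCompact_closedBall 0 R))
    fun p hp => mul_coneWeight_eq_zero hM hδ hθ hp

/-- Kato's inequality with the cone test function. Of the decay rate `L + 1`, the part `L` pays for
the source and the part `1` becomes the left side; the derivative of the initial cutoff is all that
is left on the right. -/
theorem ContinuousFlux.integral_coneTest_le (hc : ContinuousFlux f g F)
    (hu : Measurable u) (hv : Measurable v) (huC : ∀ p, |u p| ≤ C) (hvC : ∀ p, |v p| ≤ C)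
    (hue : IsEntropic T f g F u) (hve : IsEntropic T f g F v)
    (hM : 0 ≤ M) (hfM : ∀ p a b, |a| ≤ C → |b| ≤ C → ‖f p a - f p b‖ ≤ M * |a - b|)
    (hFL : ∀ p a b, |a| ≤ C → |b| ≤ C → |F p a - F p b| ≤ L * |a - b|)
    (hδ : 0 < δ) (hT : T' < T) :
    ∫ p, |u p - v p| * coneTest L M R T' δ p ≤
      ∫ p, |u p - v p| * (deriv Real.smoothTransition (p.1 / δ - 1) *
        coneWeight L M R T' p) / δ := by
  have hψ : IsTestFunction T (coneTest (d := d) L M R T' δ) := isTestFunction_coneTest hM hδ hT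
  have hψ' : Continuous (fderiv ℝ (coneTest (d := d) L M R T' δ)) :=
    hψ.contDiff.continuous_fderiv (by simp)
  have hw : Measurable fun p => |u p - v p| := (hu.sub hv).abs
  have hwC : ∀ p, |(|u p - v p|)| ≤ 2 * C := fun p => by
    rw [abs_abs]
    linarith [abs_sub (u p) (v p), huC p, hvC p]
  have i1 : Integrable fun p => |u p - v p| * coneTest L M R T' δ p :=
    integrable_mul_coneWeight hM hδ Real.smoothTransition.continuous
      (fun s hs => Real.smoothTransition.zero_of_nonpos hs.le) hw hwC
  have i2 : Integrable fun p => |u p - v p| * (deriv Real.smoothTransition (p.1 / δ - 1) *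
      coneWeight L M R T' p) / δ :=
    (integrable_mul_coneWeight hM hδ continuous_deriv_smoothTransition
      (fun s hs => deriv_smoothTransition_eq_zero fun h => absurd h.1 (not_le.2 hs)) hw
      hwC).div_const δ
  have key := hc.integral_kato_nonneg hu hv huC hvC hue hve hψ
  have i3 : Integrable fun p => Real.sign (u p - v p) *
      ((u p - v p) * fderiv ℝ (coneTest L M R T' δ) p (1, 0)
      + fderiv ℝ (coneTest L M R T' δ) p (0, f p (u p) - f p (v p))
      + (F p (u p) - F p (v p)) * coneTest L M R T' δ p) := by
    refine integrable_sign_mul volume (K := tsupport (coneTest (d := d) L M R T' δ))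
      (G := fun p a b => (a - b) * fderiv ℝ (coneTest L M R T' δ) p (1, 0)
      + fderiv ℝ (coneTest L M R T' δ) p (0, f p a - f p b)
      + (F p a - F p b) * coneTest L M R T' δ p) ?_ hψ.hasCompactSupport ?_ hu hv huC hvC
    · have ha : Continuous fun x : (ℝ × Space d) × ℝ × ℝ => (x.1, x.2.1) := by fun_prop
      have hb : Continuous fun x : (ℝ × Space d) × ℝ × ℝ => (x.1, x.2.2) := by fun_prop
      have h1 := (hc.cont_f.comp ha).sub (hc.cont_f.comp hb)
      have h2 := (hc.cont_F.comp ha).sub (hc.cont_F.comp hb)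
      have h3 : Continuous fun x : (ℝ × Space d) × ℝ × ℝ => x.2.1 - x.2.2 := by fun_prop
      exact ((h3.mul ((hψ'.comp continuous_fst).clm_apply continuous_const)).add
        ((hψ'.comp continuous_fst).clm_apply (continuous_const.prodMk h1))).add
        (h2.mul (hψ.contDiff.continuous.comp continuous_fst))
    · intro p hp a b
      have e1 := image_eq_zero_of_notMem_tsupport hp
      have e2 := image_eq_zero_of_notMem_tsupport (f := fderiv ℝ (coneTest L M R T' δ))
        fun h => hp (tsupport_fderiv_subset ℝ h)
      simp [e1, e2]
  have hle := integral_mono i3 (i2.sub i1) fun p => ?_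
  · have h2 := key.trans hle
    rw [integral_sub' i2 i1] at h2
    linarith
  · obtain ⟨ℓ, hℓ, hℓle⟩ := exists_hasFDerivAt_coneWeight (L := L) (M := M) (R := R) (T' := T') p
    have hcone := hℓle |u p - v p| _ (abs_nonneg _) (hfM p _ _ (huC p) (hvC p))
    have hA := Real.smoothTransition.nonneg (p.1 / δ - 1)
    have hW : 0 ≤ coneWeight L M R T' p := coneWeight_nonneg p
    have hs : Real.sign (u p - v p) * (u p - v p) = |u p - v p| :=
      sign_mul_self_eq_abs _
    have hsle : ∀ y, Real.sign (u p - v p) * y ≤ |y| := fun y => by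
      refine (le_abs_self _).trans ?_
      rw [abs_mul]
      exact mul_le_of_le_one_left (abs_nonneg _) (abs_sign_le_one _)
    have h1 := hsle (ℓ (0, f p (u p) - f p (v p)))
    have h2 := (hsle (F p (u p) - F p (v p))).trans (hFL p _ _ (huC p) (hvC p))
    simp only [Pi.sub_apply, (hasFDerivAt_coneTest p hℓ).fderiv, add_apply, smul_apply,
      ContinuousLinearMap.coe_fst', smul_eq_mul, mul_one, mul_zero, add_zero]
    have hT : coneTest L M R T' δ p = Real.smoothTransition (p.1 / δ - 1) * coneWeight L M R T' p :=
      rfl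
    rw [hT]
    generalize Real.smoothTransition (p.1 / δ - 1) = A at *
    generalize coneWeight L M R T' p = W at *
    generalize deriv Real.smoothTransition (p.1 / δ - 1) = A' at *
    have h3 := mul_le_mul_of_nonneg_left h2 (mul_nonneg hA hW)
    have h4 := mul_le_mul_of_nonneg_left (add_le_add_right h1 (|u p - v p| * ℓ (1, 0))) hA
    have h5 := mul_le_mul_of_nonneg_left hcone hA
    calc _ = A * (Real.sign (u p - v p) * (u p - v p) * ℓ (1, 0)
              + Real.sign (u p - v p) * ℓ (0, f p (u p) - f p (v p)))
            + Real.sign (u p - v p) * (u p - v p) * (A' * W) / δ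
            + A * W * (Real.sign (u p - v p) * (F p (u p) - F p (v p))) := by ring
      _ ≤ _ := by rw [hs]; linarith

end Cone

end

/-! ### Initial layer and uniqueness for bounded entropy solutions. -/

section

variable {d : ℕ}

section Uniqueness

variable {L M R T' δ T : ℝ}
variable {f : ℝ × Space d → ℝ → Space d} {g : ℝ × Space d → ℝ → Space d →L[ℝ] Space d}
  {F : ℝ × Space d → ℝ → ℝ} {C : ℝ} {u v : ℝ × Space d → ℝ}

/-- The derivative of the cutoff lives on `[δ, 2δ]`, and the length `δ` of that interval offsets the
factor `1 / δ`; the cone weight is at most one and vanishes outside the ball of radius `R`. -/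
theorem integral_initial_layer_le (hu : Measurable u) (hv : Measurable v) (hL : 0 ≤ L) (hM : 0 ≤ M)
    (hδ : 0 < δ) {B ε : ℝ} (hε : 0 ≤ ε) (hB : ∀ x, deriv Real.smoothTransition x ≤ B)
    (hI : ∀ᵐ t, t ∈ Icc δ (2 * δ) →
      ∫⁻ x in Metric.ball (0 : Space d) R, ‖u (t, x) - v (t, x)‖ₑ ≤ ENNReal.ofReal ε) :
    ∫ p, |u p - v p| * (deriv Real.smoothTransition (p.1 / δ - 1) *
        coneWeight L M R T' p) / δ ≤ B * ε := by
  have hB0 : 0 ≤ B := (deriv_smoothTransition_nonneg 0).trans (hB 0)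
  have hBδ : 0 ≤ B / δ := div_nonneg hB0 hδ.le
  set Y : ℝ × Space d → ℝ := fun p => |u p - v p| *
    (deriv Real.smoothTransition (p.1 / δ - 1) * coneWeight L M R T' p) / δ with hY
  have hY0 : ∀ p, 0 ≤ Y p := fun p => div_nonneg (mul_nonneg (abs_nonneg _)
    (mul_nonneg (deriv_smoothTransition_nonneg _) (coneWeight_nonneg p))) hδ.le
  have hmY : Measurable Y := by
    refine (((hu.sub hv).abs).mul (Continuous.measurable ?_)).div_const δ
    have := continuous_deriv_smoothTransition
    have := (contDiff_coneWeight (d := d) (L := L) (M := M) (R := R) (T' := T')).continuous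
    fun_prop
  have hpt : ∀ t x, ENNReal.ofReal (Y (t, x)) ≤ (Icc δ (2 * δ)).indicator
      (fun t => ENNReal.ofReal (B / δ) * (Metric.ball (0 : Space d) R).indicator
        (fun x => ‖u (t, x) - v (t, x)‖ₑ) x) t := by
    intro t x
    by_cases ht : t ∈ Icc δ (2 * δ)
    · rw [indicator_of_mem ht]
      have ht0 : 0 ≤ t := hδ.le.trans ht.1
      by_cases hx : x ∈ Metric.ball (0 : Space d) R
      · rw [indicator_of_mem hx, Real.enorm_eq_ofReal_abs, ← ENNReal.ofReal_mul hBδ]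
        refine ENNReal.ofReal_le_ofReal ?_
        have h1 : deriv Real.smoothTransition (t / δ - 1) * coneWeight L M R T' (t, x) ≤ B :=
          (mul_le_of_le_one_right (deriv_smoothTransition_nonneg _)
            (coneWeight_le_one hL ht0)).trans (hB _)
        rw [hY, div_mul_eq_mul_div, mul_comm B]
        exact div_le_div_of_nonneg_right (mul_le_mul_of_nonneg_left h1 (abs_nonneg _)) hδ.le
      · have hx' : R ≤ ‖x‖ := by simpa using hx
        rw [hY]
        simp [coneWeight_eq_zero_of_norm (p := (t, x)) (L := L) (T' := T') hM ht0 hx']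
    · have hz : t / δ - 1 ∉ Icc (0 : ℝ) 1 := by
        intro h
        refine ht ⟨?_, ?_⟩
        · have := (le_div_iff₀ hδ).1 (sub_nonneg.1 h.1)
          linarith
        · have := (div_le_iff₀ hδ).1 (by linarith [h.2] : t / δ ≤ 2)
          linarith
      rw [hY]
      simp [deriv_smoothTransition_eq_zero hz]
  rw [integral_eq_lintegral_of_nonneg_ae (Eventually.of_forall hY0) hmY.aestronglyMeasurable]
  refine ENNReal.toReal_le_of_le_ofReal (mul_nonneg hB0 hε) ?_
  rw [Measure.volume_eq_prod, lintegral_prod _ hmY.ennreal_ofReal.aemeasurable]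
  calc ∫⁻ t, ∫⁻ x, ENNReal.ofReal (Y (t, x))
      ≤ ∫⁻ t, (Icc δ (2 * δ)).indicator
          (fun _ => ENNReal.ofReal (B / δ) * ENNReal.ofReal ε) t := by
        refine lintegral_mono_ae ?_
        filter_upwards [hI] with t ht
        refine (lintegral_mono (hpt t)).trans ?_
        by_cases h : t ∈ Icc δ (2 * δ)
        · simp only [indicator_of_mem h]
          rw [lintegral_const_mul' _ _ ENNReal.ofReal_ne_top,
            lintegral_indicator Metric.isOpen_ball.measurableSet]
          gcongr
          exact ht h
        · simp only [indicator_of_notMem h, lintegral_zero, le_refl]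
    _ = ENNReal.ofReal (B * ε) := by
        rw [lintegral_indicator measurableSet_Icc, setLIntegral_const, Real.volume_Icc,
          ← ENNReal.ofReal_mul hBδ, ← ENNReal.ofReal_mul (mul_nonneg hBδ hε)]
        congr 1
        field_simp
        ring

/-- Uniqueness for bounded entropy solutions with the same initial trace. -/
theorem ContinuousFlux.ae_eq_of_isEntropic (hc : ContinuousFlux f g F)
    (hu : Measurable u) (hv : Measurable v) (huC : ∀ p, |u p| ≤ C) (hvC : ∀ p, |v p| ≤ C)
    (hue : IsEntropic T f g F u) (hve : IsEntropic T f g F v) (hL : 0 ≤ L) (hM : 0 ≤ M)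
    (hfM : ∀ p a b, |a| ≤ C → |b| ≤ C → ‖f p a - f p b‖ ≤ M * |a - b|)
    (hFL : ∀ p a b, |a| ≤ C → |b| ≤ C → |F p a - F p b| ≤ L * |a - b|)
    (hI : ∀ R > 0, ∀ ε > 0, ∃ δ > 0, ∀ᵐ t, t ∈ Ioo (0 : ℝ) δ →
      ∫⁻ x in Metric.ball (0 : Space d) R, ‖u (t, x) - v (t, x)‖ₑ ≤ ENNReal.ofReal ε) :
    ∀ᵐ p : ℝ × Space d, p.1 ∈ Ioo (0 : ℝ) T → u p = v p := by
  obtain ⟨B, hB⟩ := exists_deriv_smoothTransition_le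
  have hB0 : 0 ≤ B := (deriv_smoothTransition_nonneg 0).trans (hB 0)
  have hw : Measurable fun p => |u p - v p| := (hu.sub hv).abs
  have hwC : ∀ p, |(|u p - v p|)| ≤ 2 * C := fun p => by
    rw [abs_abs]
    linarith [abs_sub (u p) (v p), huC p, hvC p]
  have i1 : ∀ {δ R T' : ℝ}, 0 < δ → Integrable fun p => |u p - v p| * coneTest L M R T' δ p :=
    fun hδ => integrable_mul_coneWeight hM hδ Real.smoothTransition.continuous
      (fun s hs => Real.smoothTransition.zero_of_nonpos hs.le) hw hwC
  have hnn : ∀ {δ R T' : ℝ} (p), 0 ≤ |u p - v p| * coneTest L M R T' δ p := fun p =>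
    mul_nonneg (abs_nonneg _) (coneTest_nonneg p)
  have main : ∀ R > 0, ∀ T' < T, ∀ δ₀ > 0, ∀ᵐ p : ℝ × Space d,
      |u p - v p| * coneTest L M R T' δ₀ p = 0 := by
    intro R hR T' hT' δ₀ hδ₀
    have hle : ∫ p, |u p - v p| * coneTest L M R T' δ₀ p ≤ 0 := by
      refine le_of_forall_pos_le_add fun η hη => ?_
      -- The shift by `1` avoids dividing by zero and still gives `B * ε ≤ η`.
      set ε := η / (B + 1) with hε
      have hε0 : 0 < ε := by positivity
      obtain ⟨δ₁, hδ₁, hI'⟩ := hI R hR ε hε0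
      -- Shrinking `δ` only increases the test function, so the integral with `δ₀` is controlled by
      -- the one with `δ`, whose layer `[δ, 2δ]` lies inside `(0, δ₁)`.
      set δ := min δ₀ (δ₁ / 3) with hδdef
      have hδ : 0 < δ := lt_min hδ₀ (by positivity)
      have hδδ₁ : 2 * δ < δ₁ := by linarith [min_le_right δ₀ (δ₁ / 3)]
      calc ∫ p, |u p - v p| * coneTest L M R T' δ₀ p
          ≤ ∫ p, |u p - v p| * coneTest L M R T' δ p := by
            refine integral_mono (i1 hδ₀) (i1 hδ) fun p => ?_
            refine mul_le_mul_of_nonneg_left ?_ (abs_nonneg _)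
            by_cases hp : p.1 < 0
            · rw [coneTest, Real.smoothTransition.zero_of_nonpos, zero_mul]
              · exact coneTest_nonneg p
              · linarith [div_neg_of_neg_of_pos hp hδ₀]
            · refine mul_le_mul_of_nonneg_right (Real.smoothTransition.monotone ?_)
                (coneWeight_nonneg p)
              have := div_le_div_of_nonneg_left (not_lt.1 hp) hδ (min_le_left δ₀ (δ₁ / 3))
              linarith
        _ ≤ _ := hc.integral_coneTest_le hu hv huC hvC hue hve hM hfM hFL hδ hT'
        _ ≤ B * ε := integral_initial_layer_le hu hv hL hM hδ hε0.le hB (by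
            filter_upwards [hI'] with t ht h
            exact ht ⟨hδ.trans_le h.1, h.2.trans_lt hδδ₁⟩)
        _ ≤ 0 + η := by
            rw [hε, zero_add, mul_div_assoc', div_le_iff₀ (by positivity)]
            nlinarith
    exact (integral_eq_zero_iff_of_nonneg hnn (i1 hδ₀)).1
      (le_antisymm hle (integral_nonneg hnn))
  -- Countably many truncated cones exhaust `(0,T) × ℝᵈ`, so one null set serves for all of them.
  have hall : ∀ᵐ p : ℝ × Space d, ∀ n : ℕ, |u p - v p| *
      coneTest L M (n + 1) (T - 1 / ((n : ℝ) + 1)) (1 / ((n : ℝ) + 1)) p = 0 := by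
    rw [ae_all_iff]
    exact fun n => main _ (by positivity) _ (sub_lt_self _ Nat.one_div_pos_of_nat) _
      Nat.one_div_pos_of_nat
  filter_upwards [hall] with p hp hpT
  have hlim : Tendsto (fun n : ℕ => 1 / ((n : ℝ) + 1)) atTop (𝓝 0) :=
    tendsto_one_div_add_atTop_nhds_zero_nat
  have hlim2 : Tendsto (fun n : ℕ => (n : ℝ) + 1) atTop atTop :=
    tendsto_atTop_add_const_right _ _ tendsto_natCast_atTop_atTop
  obtain ⟨n, h1, h2, h3⟩ := ((hlim.eventually_lt_const hpT.1).and
    ((hlim.eventually_lt_const (sub_pos.2 hpT.2)).and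
      (hlim2.eventually_gt_atTop (√(1 + ‖p.2‖ ^ 2) + M * p.1)))).exists
  have hpos : 0 < coneTest L M (n + 1) (T - 1 / ((n : ℝ) + 1)) (1 / ((n : ℝ) + 1)) p := by
    refine mul_pos (Real.smoothTransition.pos_of_pos ?_) (coneWeight_pos (by linarith) h3)
    rw [sub_pos, one_lt_div Nat.one_div_pos_of_nat]
    exact h1
  have := (mul_eq_zero.1 (hp n)).resolve_right hpos.ne'
  exact sub_eq_zero.1 (abs_eq_zero.1 this)

end Uniqueness

end

/-! ### Passage from the slab to all times, and the initial datum. -/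

section

variable {d : ℕ} {T : ℝ}

/-- The extension to all times of a function on `[0,T] × ℝᵈ × ℝ` which is constant in time outside
of `[0,T]`. -/
def extendTime {V : Type*} (hT : 0 ≤ T) (h : ℝ → Space d → ℝ → V) (p : ℝ × Space d) (w : ℝ) : V :=
  h (projIcc 0 T hT p.1) p.2 w

theorem extendTime_of_mem {V : Type*} (hT : 0 ≤ T) (h : ℝ → Space d → ℝ → V) {p : ℝ × Space d}
    (hp : p.1 ∈ Icc (0 : ℝ) T) (w : ℝ) : extendTime hT h p w = h p.1 p.2 w := by
  rw [extendTime, projIcc_of_mem hT hp]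

theorem ContinuousOnSlab.continuous_extendTime {V : Type*} [TopologicalSpace V]
    {h : ℝ → Space d → ℝ → V} (hh : ContinuousOnSlab T h) (hT : 0 ≤ T) :
    Continuous fun z : (ℝ × Space d) × ℝ => extendTime hT h z.1 z.2 := by
  have hπ : Continuous fun z : (ℝ × Space d) × ℝ =>
      (((projIcc 0 T hT z.1.1 : Icc (0 : ℝ) T) : ℝ), z.1.2, z.2) :=
    (continuous_subtype_val.comp (continuous_projIcc.comp (by fun_prop))).prodMk (by fun_prop)
  exact ContinuousOn.comp_continuous hh hπ fun z => ⟨(projIcc 0 T hT z.1.1).2, trivial⟩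

variable {f : ℝ → Space d → ℝ → Space d} {F : ℝ → Space d → ℝ → ℝ}

theorem H1.continuousFlux (h : H1 T f F) (hT : 0 ≤ T) :
    ContinuousFlux (extendTime hT f) (extendTime hT (gradX f)) (extendTime hT F) where
  cont_f := h.cont_f.continuous_extendTime hT
  cont_g := h.cont_gradX_f.continuous_extendTime hT
  cont_F := h.cont_F.continuous_extendTime hT
  hasFDerivAt t x w := (h.diff_x_f _ (projIcc 0 T hT t).2 x w).hasFDerivAt

theorem BoundedOnSlab.exists_lipschitz {V : Type*} [NormedAddCommGroup V] [NormedSpace ℝ V]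
    {h : ℝ → Space d → ℝ → V} (hb : BoundedOnSlab T (derivU h))
    (hd : ∀ t ∈ Icc (0 : ℝ) T, ∀ x u, DifferentiableAt ℝ (fun w => h t x w) u) (hT : 0 ≤ T)
    {C : ℝ} (hC : 0 < C) : ∃ M : ℝ, 0 ≤ M ∧ ∀ p a b, |a| ≤ C → |b| ≤ C →
      ‖extendTime hT h p a - extendTime hT h p b‖ ≤ M * |a - b| := by
  obtain ⟨M, hM⟩ := hb C hC
  refine ⟨|M|, abs_nonneg M, fun p a b ha hb => ?_⟩
  have ht := (projIcc 0 T hT p.1).2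
  exact (convex_Icc (-C) C).norm_image_sub_le_of_norm_deriv_le
    (f := fun w => h (projIcc 0 T hT p.1) p.2 w) (fun w _ => hd _ ht p.2 w)
    (fun w hw => (hM _ ht p.2 w hw).trans (le_abs_self M)) (abs_le.1 hb) (abs_le.1 ha)

theorem exists_bounded_representative {u : ℝ → Space d → ℝ}
    (hu : MemLp (fun p : ℝ × Space d => u p.1 p.2) ⊤ (slab d T)) :
    ∃ (w : ℝ × Space d → ℝ) (C : ℝ), Measurable w ∧ (∀ p, |w p| ≤ C) ∧
      ∀ᵐ p ∂(slab d T), w p = u p.1 p.2 := by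
  set C := (eLpNorm (fun p : ℝ × Space d => u p.1 p.2) ⊤ (slab d T)).toReal with hC
  have hC0 : 0 ≤ C := ENNReal.toReal_nonneg
  set w₀ := hu.1.mk with hw₀
  refine ⟨fun p => max (-C) (min C (w₀ p)), C,
    measurable_const.max (measurable_const.min hu.1.stronglyMeasurable_mk.measurable),
    fun p => abs_le.2 ⟨le_max_left _ _, max_le (by linarith) (min_le_left _ _)⟩, ?_⟩
  have hb : ∀ᵐ p ∂(slab d T), ‖u p.1 p.2‖ ≤ C := by
    have := ae_le_eLpNormEssSup (f := fun p : ℝ × Space d => u p.1 p.2) (μ := slab d T)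
    filter_upwards [this] with p hp
    rw [← eLpNorm_exponent_top] at hp
    rw [hC, ← toReal_enorm]
    exact ENNReal.toReal_mono hu.2.ne hp
  filter_upwards [hu.1.ae_eq_mk, hb] with p h1 h2
  rw [hw₀, ← h1]
  rw [Real.norm_eq_abs, abs_le] at h2
  rw [min_eq_right h2.2, max_eq_right h2.1]

/-- Test functions vanish off `(0,T)`, so neither the values of `w` outside the slab nor the
extension of the coefficients matter. -/
theorem IsWeakEntropySolution.isEntropic {u₀ : Space d → ℝ} {u : ℝ → Space d → ℝ}
    (hu : IsWeakEntropySolution T f F u₀ u) (hT : 0 ≤ T) {w : ℝ × Space d → ℝ}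
    (hw : ∀ᵐ p ∂(slab d T), w p = u p.1 p.2) :
    IsEntropic T (extendTime hT f) (extendTime hT (gradX f)) (extendTime hT F) w := by
  intro k φ hφ
  refine (hu.entropy k φ hφ.contDiff hφ.hasCompactSupport hφ.tsupport_subset hφ.nonneg).trans_eq ?_
  have hms : MeasurableSet (Icc (0 : ℝ) T ×ˢ (univ : Set (Space d))) :=
    measurableSet_Icc.prod MeasurableSet.univ
  refine Eq.trans (integral_congr_ae ?_)
    (setIntegral_eq_integral_of_forall_compl_eq_zero (s := Icc (0 : ℝ) T ×ˢ univ) fun p hp => ?_)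
  · filter_upwards [hw, ae_restrict_mem hms] with p hp hpm
    simp only [entropyIntegrand, kruzkovForm, extendTime_of_mem hT _ hpm.1, hp]
    rw [← sign_mul_self_eq_abs]
    change _ = _ * (_ + _ + (_ - divX f p.1 p.2 k) * _)
    ring
  · have hpφ : p ∉ tsupport φ := fun h =>
      hp ⟨Ioo_subset_Icc_self (hφ.tsupport_subset h).1, trivial⟩
    have e1 := image_eq_zero_of_notMem_tsupport hpφ
    have e2 := image_eq_zero_of_notMem_tsupport (f := fderiv ℝ φ)
      fun h => hpφ (tsupport_fderiv_subset ℝ h)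
    simp [kruzkovForm, e1, e2]

theorem ae_ae_of_ae_slab {P : ℝ × Space d → Prop} (h : ∀ᵐ p ∂(slab d T), P p) :
    ∀ᵐ t : ℝ, t ∈ Icc (0 : ℝ) T → ∀ᵐ x : Space d, P (t, x) := by
  rw [slab, ae_restrict_iff' (measurableSet_Icc.prod MeasurableSet.univ),
    Measure.volume_eq_prod] at h
  filter_upwards [Measure.ae_ae_of_ae_prod h] with t ht htm
  filter_upwards [ht] with x hx using hx ⟨htm, trivial⟩

/-- Additivity of the lower integral needs measurability of one summand only, so `b` is arbitrary.
-/
theorem lintegral_enorm_sub_le {X : Type*} [MeasurableSpace X] {μ : Measure X} {a b c : X → ℝ}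
    (ha : AEStronglyMeasurable a μ) (hc : AEStronglyMeasurable c μ) :
    ∫⁻ x, ‖a x - b x‖ₑ ∂μ ≤ ∫⁻ x, ‖a x - c x‖ₑ ∂μ + ∫⁻ x, ‖b x - c x‖ₑ ∂μ := by
  have hm : AEMeasurable (fun x => ‖a x - c x‖ₑ) μ := (ha.sub hc).enorm
  rw [← lintegral_add_left' hm]
  refine lintegral_mono fun x => ?_
  have : a x - b x = (a x - c x) - (b x - c x) := by ring
  rw [this]
  exact enorm_sub_le

/-- The exceptional set of times is null, so a limit along its complement is a statement about
almost every small time. -/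
theorem IsWeakEntropySolution.exists_initial_le {u₀ : Space d → ℝ} {u : ℝ → Space d → ℝ}
    (hu : IsWeakEntropySolution T f F u₀ u) {R : ℝ} (hR : 0 < R) {ε : ℝ≥0∞} (hε : 0 < ε) :
    ∃ δ > 0, ∀ᵐ t : ℝ, t ∈ Ioo (0 : ℝ) δ → t ∈ Icc (0 : ℝ) T →
      AEStronglyMeasurable (u t) volume ∧
      ∫⁻ x in Metric.ball (0 : Space d) R, ‖u t x - u₀ x‖ₑ ≤ ε := by
  obtain ⟨N, -, hN0, hNm, hNt⟩ := hu.initial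
  have h1 := (hNt R hR).eventually_le_const hε
  rw [eventually_nhdsWithin_iff, Metric.eventually_nhds_iff] at h1
  obtain ⟨δ, hδ, h⟩ := h1
  refine ⟨δ, hδ, ?_⟩
  have hN' : ∀ᵐ t : ℝ, t ∉ N := measure_eq_zero_iff_ae_notMem.1 hN0
  filter_upwards [hN'] with t htN ht htT
  refine ⟨hNm t ⟨htT, htN⟩, h ?_ ⟨⟨ht.1, htT.2⟩, htN⟩⟩
  rw [Real.dist_eq, sub_zero, abs_of_pos ht.1]
  exact ht.2

/-- Uniqueness of weak entropy solutions. -/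
theorem IsWeakEntropySolution.ae_eq (hT : 0 < T) (h1 : H1 T f F)
    (hF : BoundedOnSlab T (derivU F)) {u₀ : Space d → ℝ} (hu₀ : AEStronglyMeasurable u₀ volume)
    {u v : ℝ → Space d → ℝ} (hu : IsWeakEntropySolution T f F u₀ u)
    (hv : IsWeakEntropySolution T f F u₀ v) :
    ∀ᵐ p ∂(slab d T), v p.1 p.2 = u p.1 p.2 := by
  obtain ⟨u', Cu, hu'm, hu'C, hu'⟩ := exists_bounded_representative hu.memLp
  obtain ⟨v', Cv, hv'm, hv'C, hv'⟩ := exists_bounded_representative hv.memLp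
  set C := max 1 (max Cu Cv) with hC
  have hC0 : 0 < C := lt_of_lt_of_le one_pos (le_max_left _ _)
  have hu'C' : ∀ p, |u' p| ≤ C := fun p =>
    (hu'C p).trans ((le_max_left _ _).trans (le_max_right _ _))
  have hv'C' : ∀ p, |v' p| ≤ C := fun p =>
    (hv'C p).trans ((le_max_right _ _).trans (le_max_right _ _))
  obtain ⟨M, hM0, hM⟩ := h1.bdd_derivU_f.exists_lipschitz h1.diff_u_f hT.le hC0
  obtain ⟨L, hL0, hL⟩ := hF.exists_lipschitz h1.diff_u_F hT.le hC0
  have key := (h1.continuousFlux hT.le).ae_eq_of_isEntropic hu'm hv'm hu'C' hv'C'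
    (hu.isEntropic hT.le hu') (hv.isEntropic hT.le hv') hL0 hM0 hM hL ?_
  -- Equality is known for times in the open interval; the two end slices are null.
  · have hne : ∀ c : ℝ, ∀ᵐ p : ℝ × Space d, p.1 ≠ c := fun c =>
      Measure.quasiMeasurePreserving_fst.ae
        (measure_eq_zero_iff_ae_notMem.1 (Real.volume_singleton (a := c)))
    filter_upwards [ae_restrict_of_ae key, hu', hv', ae_restrict_of_ae (hne 0),
      ae_restrict_of_ae (hne T),
      ae_restrict_mem (measurableSet_Icc.prod MeasurableSet.univ)] with p h2 h3 h4 h5 h6 h7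
    rw [← h3, ← h4]
    exact (h2 ⟨lt_of_le_of_ne h7.1.1 (Ne.symm h5), lt_of_le_of_ne h7.1.2 h6⟩).symm
  · intro R hR ε hε
    have hε2 : 0 < ENNReal.ofReal (ε / 2) := ENNReal.ofReal_pos.2 (by positivity)
    obtain ⟨δu, hδu, hIu⟩ := hu.exists_initial_le hR hε2
    obtain ⟨δv, hδv, hIv⟩ := hv.exists_initial_le hR hε2
    refine ⟨min T (min δu δv), lt_min hT (lt_min hδu hδv), ?_⟩
    filter_upwards [hIu, hIv, ae_ae_of_ae_slab hu', ae_ae_of_ae_slab hv'] with t h1 h2 h3 h4 ht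
    rw [mem_Ioo, lt_min_iff, lt_min_iff] at ht
    have htT : t ∈ Icc (0 : ℝ) T := ⟨ht.1.le, ht.2.1.le⟩
    obtain ⟨h1m, h1⟩ := h1 ⟨ht.1, ht.2.2.1⟩ htT
    obtain ⟨-, h2⟩ := h2 ⟨ht.1, ht.2.2.2⟩ htT
    calc ∫⁻ x in Metric.ball (0 : Space d) R, ‖u' (t, x) - v' (t, x)‖ₑ
        = ∫⁻ x in Metric.ball (0 : Space d) R, ‖u t x - v t x‖ₑ := by
          refine lintegral_congr_ae (ae_restrict_of_ae ?_)
          filter_upwards [h3 htT, h4 htT] with x h5 h6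
          rw [h5, h6]
      _ ≤ ENNReal.ofReal (ε / 2) + ENNReal.ofReal (ε / 2) :=
          (lintegral_enorm_sub_le h1m.restrict hu₀.restrict).trans (add_le_add h1 h2)
      _ = ENNReal.ofReal ε := by
          rw [← ENNReal.ofReal_add (by positivity) (by positivity), add_halves]

/-- Right-continuous representatives of the same class in `L^∞([0,T] × ℝᵈ)` agree at every time. -/
theorem RightContinuousL1loc.ae_eq {u v : ℝ → Space d → ℝ} (hu : RightContinuousL1loc T u)
    (hv : RightContinuousL1loc T v) (huv : ∀ᵐ p ∂(slab d T), v p.1 p.2 = u p.1 p.2)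
    {t : ℝ} (ht : t ∈ Ico (0 : ℝ) T) : v t =ᵐ[volume] u t := by
  have htI : t ∈ Icc (0 : ℝ) T := Ico_subset_Icc_self ht
  have hball : ∀ n : ℕ, ∫⁻ x in Metric.ball (0 : Space d) ((n : ℝ) + 1), ‖v t x - u t x‖ₑ = 0 := by
    intro n
    have hr : (0 : ℝ) < (n : ℝ) + 1 := by positivity
    have hae : ∃ᶠ s in 𝓝[Ioc t T] t, s ∈ Ioc t T ∧ v s =ᵐ[volume] u s := by
      rw [frequently_iff]
      intro U hU
      obtain ⟨δ, hδ, hδU⟩ := Metric.mem_nhdsWithin_iff.1 hU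
      -- Times at which the slices agree have full measure in `[0,T]`, hence meet every interval to
      -- the right of `t`; that this interval is nonempty is where `t < T` enters.
      obtain ⟨s, hs, hts, hst⟩ := (Measure.dense_of_ae (ae_ae_of_ae_slab huv)).exists_mem_open
        (isOpen_Ioo (a := t) (b := min T (t + δ)))
        (nonempty_Ioo.2 (lt_min ht.2 (lt_add_of_pos_right t hδ)))
      rw [lt_min_iff] at hst
      refine ⟨s, hδU ⟨?_, hts, hst.1.le⟩, ⟨hts, hst.1.le⟩, hs ⟨ht.1.trans hts.le, hst.1.le⟩⟩
      rw [Metric.mem_ball, Real.dist_eq, abs_of_pos (sub_pos.2 hts)]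
      linarith [hst.2]
    have hlim := (hv.2 t htI _ hr).add (hu.2 t htI _ hr)
    rw [add_zero] at hlim
    refine le_antisymm (ge_of_tendsto_of_frequently hlim (hae.mono fun s hs => ?_)) zero_le
    have hsI : s ∈ Icc (0 : ℝ) T := ⟨ht.1.trans hs.1.1.le, hs.1.2⟩
    have e : ∫⁻ x in Metric.ball (0 : Space d) ((n : ℝ) + 1), ‖u s x - u t x‖ₑ =
        ∫⁻ x in Metric.ball (0 : Space d) ((n : ℝ) + 1), ‖u t x - v s x‖ₑ := by
      refine lintegral_congr_ae (ae_restrict_of_ae ?_)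
      filter_upwards [hs.2] with x hx
      rw [hx, enorm_sub_rev]
    have e' : ∫⁻ x in Metric.ball (0 : Space d) ((n : ℝ) + 1), ‖v s x - v t x‖ₑ =
        ∫⁻ x in Metric.ball (0 : Space d) ((n : ℝ) + 1), ‖v t x - v s x‖ₑ :=
      lintegral_congr fun x => enorm_sub_rev _ _
    rw [e, e']
    exact lintegral_enorm_sub_le (hv.1 t htI).aestronglyMeasurable.restrict
      (hv.1 s hsI).aestronglyMeasurable.restrict
  have hz : ∀ᵐ x : Space d, ∀ n : ℕ, x ∈ Metric.ball (0 : Space d) ((n : ℝ) + 1) →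
      v t x = u t x := by
    rw [ae_all_iff]
    intro n
    have hm := ((hv.1 t htI).aestronglyMeasurable.sub
      (hu.1 t htI).aestronglyMeasurable).enorm.restrict
        (s := Metric.ball (0 : Space d) ((n : ℝ) + 1))
    have := (lintegral_eq_zero_iff' hm).1 (hball n)
    rw [EventuallyEq, ae_restrict_iff' Metric.isOpen_ball.measurableSet] at this
    filter_upwards [this] with x hx hxn
    exact sub_eq_zero.1 (enorm_eq_zero.1 (hx hxn))
  filter_upwards [hz] with x hx
  obtain ⟨n, hn⟩ := exists_nat_gt ‖x‖
  exact hx n (mem_ball_zero_iff.2 (by linarith))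

end

end ConservationLaw

end

theorem corollaryB4 {d : ℕ} {T : ℝ} (hT : 0 < T)
    -- the problem, its initial datum, and the given weak entropy solution
    (f : ℝ → ConservationLaw.Space d → ℝ → ConservationLaw.Space d)
    (F : ℝ → ConservationLaw.Space d → ℝ → ℝ)
    (u₀ : ConservationLaw.Space d → ℝ)
    (hu₀ : MemLp u₀ ⊤ volume)
    (hH1 : ConservationLaw.H1 T f F)
    (hH2 : ConservationLaw.H2Star T f F)
    (u : ℝ → ConservationLaw.Space d → ℝ)
    (hu : ConservationLaw.IsWeakEntropySolution T f F u₀ u)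
    -- the approximating problems, indexed by `ε > 0`, and their solutions
    (fε : ℝ → ℝ → ConservationLaw.Space d → ℝ → ConservationLaw.Space d)
    (Fε : ℝ → ℝ → ConservationLaw.Space d → ℝ → ℝ)
    (u₀ε : ℝ → ConservationLaw.Space d → ℝ)
    (uε : ℝ → ℝ → ConservationLaw.Space d → ℝ)
    (hu₀ε : ∀ ε : ℝ, 0 < ε → MemLp (u₀ε ε) ⊤ volume)
    (hH1ε : ∀ ε : ℝ, 0 < ε → ConservationLaw.H1 T (fε ε) (Fε ε))
    (hH2ε : ∀ ε : ℝ, 0 < ε → ConservationLaw.H2 T (fε ε) (Fε ε))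
    (huε : ∀ ε : ℝ, 0 < ε →
      ConservationLaw.IsWeakEntropySolution T (fε ε) (Fε ε) (u₀ε ε) (uε ε))
    (hbdd : ∃ C : ℝ, ∀ ε : ℝ, 0 < ε →
      ∀ᵐ p ∂(ConservationLaw.slab d T), |uε ε p.1 p.2| ≤ C)
    (hlim : ConservationLaw.TendstoL1L1loc T uε u)
    -- the data agree on larger and larger balls
    (hagree : ∀ R : ℝ, 0 < R → ∃ ε : ℝ, 0 < ε ∧
      (∀ t ∈ Icc (0 : ℝ) T, ∀ x ∈ Metric.ball (0 : ConservationLaw.Space d) R, ∀ w : ℝ,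
        fε ε t x w = f t x w ∧ Fε ε t x w = F t x w) ∧
      ∀ᵐ x ∂(volume.restrict (Metric.ball (0 : ConservationLaw.Space d) R)), u₀ε ε x = u₀ x) :
    ConservationLaw.IsWeakEntropySolution T f F u₀ u ∧
    ∀ v : ℝ → ConservationLaw.Space d → ℝ,
      ConservationLaw.IsWeakEntropySolution T f F u₀ v →
        (∀ᵐ p ∂(ConservationLaw.slab d T), v p.1 p.2 = u p.1 p.2) ∧
        (ConservationLaw.RightContinuousL1loc T u → ConservationLaw.RightContinuousL1loc T v →
          ∀ t ∈ Ico (0 : ℝ) T, v t =ᵐ[volume] u t) := by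
  refine ⟨hu, fun v hv => ?_⟩
  have hvu := hu.ae_eq hT hH1 hH2.bdd_derivU_F hu₀.1 hv
  exact ⟨hvu, fun hur hvr t ht => hur.ae_eq hvr hvu ht⟩
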